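/- Let $S^1=\mathbb R/\mathbb Z$ and let $\gamma\colon S^1\to\mathbb R^2$ be a closed curve, not necessarily simple, that is $C^3$ and regular. In a configuration $(x,y)\in S^1\times S^1$ the human is at $\gamma(x)$ and the puppy at $\gamma(y)$; put $E(x,y)=|\gamma(x)-\gamma(y)|^2$. A configuration is *forward* if $\partial_yE<0$, *backward* if $\partial_yE>0$, and *critical* if $\partial_yE=0$. A critical configuration is *stable* if $\partial_y^2E>0$, *unstable* if $\partial_y^2E<0$, a *forward pivot configuration* if $\partial_y^2E=0$ and $\partial_y^3E<0$, and a *backward pivot configuration* if $\partial_y^2E=0$ and $\partial_y^3E>0$. The track $\gamma$ is *generic* if every critical configuration is of one of these four kinds, and $\gamma'(x)\cdot\gamma'(y)\neq0$ for every pivot configuration $(x,y)$ (equivalently, $\gamma$ meets its evolute transversely and away from the cusps of the evolute). The critical configurations of a generic track form finitely many disjoint simple closed curves on the torus $S^1\times S^1$, the connected components of the critical set, which are called *critical cycles*; the main diagonal $x=y$ is one of them. A critical cycle is *contractible* if it is the boundary of a simply connected closed subset of the torus, and *essential* otherwise. While the human stands still, the puppy *runs forward* (resp. *backward*) from $(x,y)$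 by increasing (resp. decreasing) $y$ through forward configurations and forward pivot configurations (resp. backward configurations and backward pivot configurations) until it reaches a stable configuration; from an unstable configuration it may run in either direction. In a *walk* the human and the puppy move continuously through stable configurations, ending in a stable configuration or on reaching a pivot configuration. A *strategy* is a finite sequence of walks and runs that ends on the main diagonal. A configuration is *dexter* (resp. *sinister*) if it is the start of a strategy whose last step is a backward (resp. forward) run onto the main diagonal; configurations on the main diagonal, where the run is trivial, count as both. **Theorem.** Let $\gamma$ be a generic track that has exactly two essential critical cycles. Then every configuration is dexter or sinister. Consequently, from every starting configuration the human can catch the puppy, i.e. force the configuration onto the main diagonal after finitely many walks and runs, whichever way the puppy runs when it has a choice. -/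

import Mathlib

namespace Puppy

/-- The Euclidean plane. -/
abbrev Plane : Type := EuclideanSpace ℝ (Fin 2)

/-- The configuration torus `S¹ × S¹`, with `S¹ = ℝ / ℤ`. In `(x, y)` the human stands at
`γ x` and the puppy at `γ y`. -/
abbrev Config : Type := UnitAddCircle × UnitAddCircle

/-- The velocity `γ'(x)`. -/
noncomputable def velocity (γ : UnitAddCircle → Plane) (x : UnitAddCircle) : Plane :=
  deriv (fun t : ℝ => γ (x + (t : UnitAddCircle))) 0

/-- The `k`-th partial derivative, in the puppy's position `y`, of the squared distance
`D(x, y)²`. Where `D(x, y) ≠ 0`, the sign of the first nonzero derivative of order at most three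
is the same for `D` and `D²`; unlike `D`, the function `D²` is also differentiable where
`γ x = γ y`, and in particular on the main diagonal, which it makes stable. -/
noncomputable def partialY (γ : UnitAddCircle → Plane) (k : ℕ) (p : Config) : ℝ :=
  iteratedDeriv k (fun t : ℝ => dist (γ p.1) (γ (p.2 + (t : UnitAddCircle))) ^ 2) 0

def IsForward (γ : UnitAddCircle → Plane) (p : Config) : Prop := partialY γ 1 p < 0

def IsBackward (γ : UnitAddCircle → Plane) (p : Config) : Prop := 0 < partialY γ 1 p

def IsCritical (γ : UnitAddCircle → Plane) (p : Config) : Prop := partialY γ 1 p = 0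

def IsStable (γ : UnitAddCircle → Plane) (p : Config) : Prop :=
  IsCritical γ p ∧ 0 < partialY γ 2 p

def IsUnstable (γ : UnitAddCircle → Plane) (p : Config) : Prop :=
  IsCritical γ p ∧ partialY γ 2 p < 0

def IsForwardPivot (γ : UnitAddCircle → Plane) (p : Config) : Prop :=
  IsCritical γ p ∧ partialY γ 2 p = 0 ∧ partialY γ 3 p < 0

def IsBackwardPivot (γ : UnitAddCircle → Plane) (p : Config) : Prop :=
  IsCritical γ p ∧ partialY γ 2 p = 0 ∧ 0 < partialY γ 3 p

def IsPivot (γ : UnitAddCircle → Plane) (p : Config) : Prop :=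
  IsForwardPivot γ p ∨ IsBackwardPivot γ p

/-- A generic track: a closed regular `C³` curve, not necessarily simple, that meets its evolute
only away from the cusps of the evolute (`exhaustive`) and only transversely (`transverse`: at a
pivot configuration `(x, y)` the point `γ x` is the center of curvature at `γ y`, where the
evolute is tangent to the normal line of `γ` at `γ y`). -/
structure IsGenericTrack (γ : UnitAddCircle → Plane) : Prop where
  contDiff : ContDiff ℝ 3 (fun t : ℝ => γ (t : UnitAddCircle))
  regular : ∀ x, velocity γ x ≠ 0
  exhaustive : ∀ p : Config, IsCritical γ p → IsStable γ p ∨ IsUnstable γ p ∨ IsPivot γ p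
  transverse : ∀ p : Config, IsPivot γ p → inner ℝ (velocity γ p.1) (velocity γ p.2) ≠ 0

/-- The critical cycles of the attraction diagram. For a generic track the critical
configurations form a disjoint union of finitely many simple closed curves, so that these
curves are the connected components of the critical set. -/
def IsCriticalCycle (γ : UnitAddCircle → Plane) (C : Set Config) : Prop :=
  ∃ p, IsCritical γ p ∧ C = connectedComponentIn {q | IsCritical γ q} p

/-- `C` is the boundary of a simply connected closed subset of the torus. (Without `IsClosed`,
every simple closed curve would qualify: it is the boundary of the arc that is left when one of
its points is removed.) -/
def IsContractible (C : Set Config) : Prop :=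
  ∃ U : Set Config, IsClosed U ∧ SimplyConnectedSpace U ∧ frontier U = C

/-- The essential critical cycles of the attraction diagram. -/
def essentialCycles (γ : UnitAddCircle → Plane) : Set (Set Config) :=
  {C | IsCriticalCycle γ C ∧ ¬ IsContractible C}

/-- The human walks, and the puppy follows, along stable configurations from `p` to `q`; the
walk ends in a stable configuration or on reaching a pivot configuration. -/
def Walk (γ : UnitAddCircle → Plane) (p q : Config) : Prop :=
  (∃ f : Path p q, ∀ t : unitInterval, t < 1 → IsStable γ (f t)) ∧ (IsStable γ q ∨ IsPivot γ q)

/-- The puppy runs forward from `p` until it reaches the stable configuration `q`, while the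
human stands still: an upward vertical segment. -/
def ForwardRun (γ : UnitAddCircle → Plane) (p q : Config) : Prop :=
  ∃ s : ℝ, 0 < s ∧ q = (p.1, p.2 + (s : UnitAddCircle)) ∧ IsStable γ q ∧
    ∀ t ∈ Set.Ioo 0 s, IsForward γ (p.1, p.2 + (t : UnitAddCircle)) ∨
      IsForwardPivot γ (p.1, p.2 + (t : UnitAddCircle))

/-- The puppy runs backward from `p` until it reaches the stable configuration `q`, while the
human stands still: a downward vertical segment. -/
def BackwardRun (γ : UnitAddCircle → Plane) (p q : Config) : Prop :=
  ∃ s : ℝ, 0 < s ∧ q = (p.1, p.2 - (s : UnitAddCircle)) ∧ IsStable γ q ∧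
    ∀ t ∈ Set.Ioo 0 s, IsBackward γ (p.1, p.2 - (t : UnitAddCircle)) ∨
      IsBackwardPivot γ (p.1, p.2 - (t : UnitAddCircle))

/-- From an unstable configuration the puppy can run either way; from a forward or backward
configuration or a pivot configuration, only one of the two runs is possible, and from a stable
configuration none. -/
def Run (γ : UnitAddCircle → Plane) (p q : Config) : Prop :=
  ForwardRun γ p q ∨ BackwardRun γ p q

def Move (γ : UnitAddCircle → Plane) (p q : Config) : Prop := Walk γ p q ∨ Run γ p q

/-- `p` starts a strategy that ends with a backward run onto the main diagonal. On the main
diagonal itself the puppy is already caught and the final run is trivial. (The main diagonal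
cannot be left, nor can it be entered by a walk.) -/
def IsDexter (γ : UnitAddCircle → Plane) (p : Config) : Prop :=
  p.1 = p.2 ∨ ∃ q r : Config, Relation.ReflTransGen (Move γ) p q ∧ BackwardRun γ q r ∧ r.1 = r.2

/-- `p` starts a strategy that ends with a forward run onto the main diagonal. -/
def IsSinister (γ : UnitAddCircle → Plane) (p : Config) : Prop :=
  p.1 = p.2 ∨ ∃ q r : Config, Relation.ReflTransGen (Move γ) p q ∧ ForwardRun γ q r ∧ r.1 = r.2

/-- The human can force the puppy to be caught after finitely many moves: the human chooses the
walks, and whenever the puppy runs, every possible outcome of the run has to be good for the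
human. -/
inductive CanCatch (γ : UnitAddCircle → Plane) : Config → Prop
  | caught (x : UnitAddCircle) : CanCatch γ (x, x)
  | walk (p q : Config) : Walk γ p q → CanCatch γ q → CanCatch γ p
  | run (p : Config) : (∃ q, Run γ p q) → (∀ q, Run γ p q → CanCatch γ q) → CanCatch γ p

end Puppy

/-!
In the plane covering the torus, the critical set is the zero set of `g = ∂E/∂y`, and the main
diagonal lifts to the lines `y = x + n`. Suppose that the puppy escapes from some stable
configuration. The lifts to the strip `x < y < x + 1` of all such configurations form a trap: the
set is closed under walks, and from every pivot that a walk reaches from it some run leads back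
into it. Hence it meets every vertical line. The points of `{0 ≤ g}` above the trap and their limit
points form a part `A` of `{0 ≤ g}` that is relatively open and closed, and symmetrically the
points below the trap give a part `B` of `{g ≤ 0}`. So the zeros of `g` in the strip split into
three closed sets: those outside `A`, those in `A ∩ B`, and those outside `B`. Each of them
separates the two boundary lines of the strip.

A closed and relatively open set of zeros that separates the boundary lines contains an essential
critical cycle: otherwise the circle-valued coordinate `x` would lift to a real function on that
set, and `x` on one side of the set and an extension of the lift on the other would form a
circle-valued map on the annulus with winding number `1` on one boundary line and `0` on the
other. So there would be at least three essential cycles.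
-/

namespace Puppy

open Set Filter Topology unitInterval

/-! ### Lifts of circle-valued maps -/

section CircleLifts

variable {X : Type*} [TopologicalSpace X]

theorem coe_eq_coe_iff_exists_int {a b : ℝ} :
    (a : UnitAddCircle) = b ↔ ∃ n : ℤ, b - a = n := by
  simp only [QuotientAddGroup.eq, AddSubgroup.mem_zmultiples_iff, zsmul_one, neg_add_eq_sub,
    eq_comm]

theorem sub_eq_sub_of_coe_eq_coe [PreconnectedSpace X] {f g : X → ℝ} (hf : Continuous f)
    (hg : Continuous g) (h : ∀ x, (f x : UnitAddCircle) = g x) (a b : X) :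
    f a - g a = f b - g b := by
  have hfg : f = fun x => g x + (f a - g a) := by
    refine (AddCircle.isCoveringMap_coe (1 : ℝ)).eq_of_comp_eq hf (by fun_prop) ?_ a (by ring)
    funext x
    simp only [Function.comp_apply, AddCircle.coe_add, AddCircle.coe_sub, h, sub_self, add_zero]
  linarith [congrFun hfg b]

/-- A real function on `S` that lifts the circle-valued map `f` pointwise and along every path in
`S`. It need not be continuous, because `S` need not be locally path connected. -/
structure IsPathLift (f : X → UnitAddCircle) (S : Set X) (φ : X → ℝ) : Prop where
  coe_eq : ∀ x ∈ S, (φ x : UnitAddCircle) = f x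
  sub_eq : ∀ {x y : X} (w : Path x y), (∀ t, w t ∈ S) → ∀ l : C(I, ℝ),
    (∀ t, (l t : UnitAddCircle) = f (w t)) → φ y - φ x = l 1 - l 0

theorem IsPathLift.mono {f : X → UnitAddCircle} {S T : Set X} {φ : X → ℝ} (h : IsPathLift f T φ)
    (hST : S ⊆ T) : IsPathLift f S φ where
  coe_eq x hx := h.coe_eq x (hST hx)
  sub_eq w hw := h.sub_eq w fun t => hST (hw t)

theorem exists_forall_path_lift [SimplyConnectedSpace X] (f : C(X, UnitAddCircle)) {b : X} {e : ℝ}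
    (he : (e : UnitAddCircle) = f b) :
    ∃ φ : X → ℝ, ∀ x (w : Path b x), ∃ l : Path e (φ x), ∀ t, (l t : UnitAddCircle) = f (w t) := by
  have cov := AddCircle.isCoveringMap_coe (1 : ℝ)
  let lift {x : X} (w : Path b x) : C(I, ℝ) :=
    cov.liftPath (w.map f.continuous) e (by simp [he])
  have lift_one {x : X} (v w : Path b x) : lift v 1 = lift w 1 :=
    cov.liftPath_apply_one_eq_of_homotopicRel
      ((SimplyConnectedSpace.paths_homotopic v w).map f) e _ _
  refine ⟨fun x => lift (PathConnectedSpace.somePath b x) 1, fun x w => ?_⟩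
  refine ⟨⟨lift w, cov.liftPath_zero _ _ _, lift_one _ _⟩, fun t => ?_⟩
  exact congrFun (cov.liftPath_lifts (w.map f.continuous : C(I, UnitAddCircle)) e (by simp [he])) t

theorem exists_isPathLift_univ [SimplyConnectedSpace X] (f : C(X, UnitAddCircle)) :
    ∃ φ : X → ℝ, IsPathLift f univ φ := by
  obtain ⟨b⟩ : Nonempty X := inferInstance
  obtain ⟨e, he⟩ : ∃ e : ℝ, (e : UnitAddCircle) = f b := QuotientAddGroup.mk_surjective _
  obtain ⟨φ, hφ⟩ := exists_forall_path_lift f he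
  have coe_eq (x : X) : (φ x : UnitAddCircle) = f x := by
    obtain ⟨l, hl⟩ := hφ x (PathConnectedSpace.somePath b x)
    simpa using hl 1
  refine ⟨φ, fun x _ => coe_eq x, fun {x y} w _ l hl => ?_⟩
  let v := PathConnectedSpace.somePath b x
  obtain ⟨lv, hlv⟩ := hφ x v
  obtain ⟨lvw, hlvw⟩ := hφ y (v.trans w)
  let shifted : Path (φ x) (φ x + (l 1 - l 0)) :=
    { toFun := fun t => φ x + (l t - l 0)
      continuous_toFun := by fun_prop
      source' := by simp
      target' := rfl }
  have hshifted (t : I) : (shifted t : UnitAddCircle) = f (w t) := by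
    change ((φ x + (l t - l 0) : ℝ) : UnitAddCircle) = _
    simp [hl, coe_eq]
  have hlift (t : I) : (lvw t : UnitAddCircle) = lv.trans shifted t := by
    rw [hlvw, Path.trans_apply, Path.trans_apply]
    split_ifs
    · exact (hlv _).symm
    · exact (hshifted _).symm
  have := sub_eq_sub_of_coe_eq_coe lvw.continuous (lv.trans shifted).continuous hlift 0 1
  simp only [Path.source, Path.target] at this
  linarith

theorem exists_isPathLift (f : C(X, UnitAddCircle)) (S : Set X) [SimplyConnectedSpace S] :
    ∃ φ : X → ℝ, IsPathLift f S φ := by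
  classical
  obtain ⟨φ, hφ⟩ := exists_isPathLift_univ (f.restrict S)
  have extend_eq (x : S) : Function.extend Subtype.val φ 0 x = φ x :=
    Subtype.val_injective.extend_apply _ _ _
  refine ⟨Function.extend Subtype.val φ 0, fun x hx => ?_, fun {x y} w hw l hl => ?_⟩
  · exact (congrArg _ (extend_eq ⟨x, hx⟩)).trans (hφ.coe_eq ⟨x, hx⟩ trivial)
  · let w' : Path (⟨x, by simpa using hw 0⟩ : S) ⟨y, by simpa using hw 1⟩ :=
      { toFun := fun t => ⟨w t, hw t⟩
        continuous_toFun := by fun_prop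
        source' := by simp
        target' := by simp }
    rw [← hφ.sub_eq w' (fun _ => trivial) l hl, ← extend_eq, ← extend_eq]

/-- Every point of `Z` close to `p` is joined to `p` by a small path in `Z`. -/
def WeaklyLocallyPathConnectedAt (Z : Set X) (p : X) : Prop :=
  ∀ U ∈ 𝓝 p, ∀ᶠ q in 𝓝[Z] p, JoinedIn (Z ∩ U) p q

theorem exists_nhds_lift_close (f : C(X, UnitAddCircle)) (p : X) {ε : ℝ} (hε : 0 < ε) :
    ∃ U ∈ 𝓝 p, ∀ {q : X} (w : Path p q), (∀ t, w t ∈ U) →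
      ∃ l : C(I, ℝ), (∀ t, (l t : UnitAddCircle) = f (w t)) ∧ |l 1 - l 0| < ε := by
  obtain ⟨e, he⟩ : ∃ e : ℝ, (e : UnitAddCircle) = f p := QuotientAddGroup.mk_surjective _
  obtain ⟨κ, heκ, hκ⟩ := (AddCircle.isCoveringMap_coe (1 : ℝ)).isLocalHomeomorph e
  have hκe : κ e = f p := by rw [← hκ, he]
  have hsymm : κ.symm (f p) = e := by rw [← hκe, κ.left_inv heκ]
  have hfp : f p ∈ κ.target := hκe ▸ κ.map_source heκ
  have hclose : ∀ᶠ c in 𝓝 (f p), κ.symm c ∈ Metric.ball e ε :=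
    (κ.continuousAt_symm hfp).eventually_mem (by rw [hsymm]; exact Metric.ball_mem_nhds e hε)
  refine ⟨_, f.continuous.continuousAt ((κ.open_target.eventually_mem hfp).and hclose),
    fun w hw => ?_⟩
  refine ⟨⟨fun t => κ.symm (f (w t)), κ.continuousOn_symm.comp_continuous (by fun_prop)
    fun t => (hw t).1⟩, fun t => ?_, ?_⟩
  · exact (congrFun hκ _).trans (κ.right_inv (hw t).1)
  · have := (hw 1).2
    simpa [hsymm, Real.dist_eq] using this

theorem exists_continuous_lift_of_isPathLift [NormalSpace X] (f : C(X, UnitAddCircle))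
    {K Z : Set X} (hK : IsClosed K) (hKZ : K ⊆ Z)
    (hZ : ∀ p ∈ K, WeaklyLocallyPathConnectedAt Z p)
    (hlift : ∀ p ∈ K, ∃ φ, IsPathLift f (connectedComponentIn Z p) φ) :
    ∃ Φ : C(X, ℝ), ∀ p ∈ K, (Φ p : UnitAddCircle) = f p := by
  have hchoice : ∀ C, (∃ φ, IsPathLift f C φ) → ∃ φ, IsPathLift f C φ := fun _ h => h
  choose! Θ hΘ using hchoice
  let φ (p : X) : ℝ := Θ (connectedComponentIn Z p) p
  have hφ : Continuous (K.domRestrict φ) := by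
    rw [continuous_iff_continuousAt]
    intro p
    rw [ContinuousAt, Metric.tendsto_nhds]
    intro ε hε
    obtain ⟨U, hU, hlU⟩ := exists_nhds_lift_close f p.1 hε
    have hnear : ∀ᶠ q : K in 𝓝 p, JoinedIn (Z ∩ U) p q :=
      (tendsto_nhdsWithin_iff.2 ⟨continuous_subtype_val.continuousAt,
        .of_forall fun q => hKZ q.2⟩).eventually (hZ p.1 p.2 U hU)
    filter_upwards [hnear] with q ⟨w, hw⟩
    obtain ⟨l, hl, hlε⟩ := hlU w fun t => (hw t).2
    have hwC : ∀ t, w t ∈ connectedComponentIn Z p.1 := fun t =>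
      (isPreconnected_range w.continuous).subset_connectedComponentIn ⟨0, w.source⟩
        (range_subset_iff.2 fun t => (hw t).1) ⟨t, rfl⟩
    have hC : connectedComponentIn Z q.1 = connectedComponentIn Z p.1 :=
      (connectedComponentIn_eq (by simpa using hwC 1)).symm
    have := (hΘ _ (hlift p.1 p.2)).sub_eq w hwC l hl
    change |Θ (connectedComponentIn Z q.1) q.1 - Θ (connectedComponentIn Z p.1) p.1| < ε
    rwa [hC, this]
  obtain ⟨Φ, hΦ⟩ := ContinuousMap.exists_restrict_eq hK ⟨K.domRestrict φ, hφ⟩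
  refine ⟨Φ, fun p hp => ?_⟩
  have hΦp : Φ p = φ p := congrArg (fun h : C(K, ℝ) => h ⟨p, hp⟩) hΦ
  rw [hΦp]
  exact (hΘ _ (hlift p hp)).coe_eq p (mem_connectedComponentIn (hKZ hp))

end CircleLifts

/-! ### Separations of the strip -/

/-- The winding number of a circle-valued map on the annulus, that is, on the quotient of the
plane by the diagonal translation, is the same on both lines `y = x` and `y = x + 1`. -/
theorem lift_sub_lift_eq_of_periodic {F : C(ℝ × ℝ, UnitAddCircle)}
    (hF : ∀ x y, F (x + 1, y + 1) = F (x, y)) {ψ₀ ψ₁ : ℝ → ℝ} (hψ₀ : Continuous ψ₀)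
    (hψ₁ : Continuous ψ₁) (h₀ : ∀ x, (ψ₀ x : UnitAddCircle) = F (x, x))
    (h₁ : ∀ x, (ψ₁ x : UnitAddCircle) = F (x, x + 1)) : ψ₀ 1 - ψ₀ 0 = ψ₁ 1 - ψ₁ 0 := by
  obtain ⟨Φ, ⟨-, hΦ⟩, -⟩ := (AddCircle.isCoveringMap_coe (1 : ℝ)).existsUnique_continuousMap_lifts
    F (0, 0) (ψ₀ 0) (h₀ 0)
  have hΦF (z : ℝ × ℝ) : (Φ z : UnitAddCircle) = F z := congrFun hΦ z
  have hshift := sub_eq_sub_of_coe_eq_coe (f := fun z : ℝ × ℝ => Φ (z.1 + 1, z.2 + 1)) (g := Φ)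
    (by fun_prop) (by fun_prop) (fun z => by rw [hΦF, hΦF, hF]) (0, 0) (0, 1)
  have hbot := sub_eq_sub_of_coe_eq_coe (g := fun x => Φ (x, x)) hψ₀ (by fun_prop)
    (fun x => by rw [h₀, hΦF]) 0 1
  have htop := sub_eq_sub_of_coe_eq_coe (g := fun x => Φ (x, x + 1)) hψ₁ (by fun_prop)
    (fun x => by rw [h₁, hΦF]) 0 1
  norm_num at hshift hbot htop
  linarith

/-- The sets of lifts of subsets of the annulus: they are invariant under `(1, 1)`. -/
def IsDiagPeriodic (Y : Set (ℝ × ℝ)) : Prop :=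
  ∀ x y, (x + 1, y + 1) ∈ Y ↔ (x, y) ∈ Y

/-- A cover of the strip `x ≤ y ≤ x + 1` by two periodic closed sets, one for each of the two
boundary lines. Their intersection separates the boundary lines from each other. -/
structure IsStripSeparation (P Q : Set (ℝ × ℝ)) : Prop where
  isClosed_left : IsClosed P
  isClosed_right : IsClosed Q
  isDiagPeriodic_left : IsDiagPeriodic P
  cover : ∀ x y, x ≤ y → y ≤ x + 1 → (x, y) ∈ P ∨ (x, y) ∈ Q
  bottom_mem : ∀ x, (x, x) ∈ P
  top_mem : ∀ x, (x, x + 1) ∈ Q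

theorem IsStripSeparation.exists_coe_ne {P Q : Set (ℝ × ℝ)} (hPQ : IsStripSeparation P Q)
    {φ : ℝ × ℝ → ℝ} (hφ : Continuous φ) (hφ' : ∀ x y, φ (x + 1, y + 1) = φ (x, y)) :
    ∃ x y, x ≤ y ∧ y ≤ x + 1 ∧ (x, y) ∈ P ∩ Q ∧ (φ (x, y) : UnitAddCircle) ≠ x := by
  classical
  by_contra! heq
  let ρ (z : ℝ × ℝ) : ℝ × ℝ := (z.1, max z.1 (min z.2 (z.1 + 1)))
  have hρ : Continuous ρ := by fun_prop
  have le_ρ (z) : (ρ z).1 ≤ (ρ z).2 := le_max_left _ _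
  have ρ_le (z) : (ρ z).2 ≤ (ρ z).1 + 1 := max_le (by simp [ρ]) (min_le_right _ _)
  have ρ_add_one (x y) : ρ (x + 1, y + 1) = ((ρ (x, y)).1 + 1, (ρ (x, y)).2 + 1) := by
    simp [ρ, max_add_add_right, min_add_add_right]
  let F (z : ℝ × ℝ) : UnitAddCircle := if ρ z ∈ P then (φ (ρ z) : UnitAddCircle) else z.1
  have F_of_right (z) (hz : ρ z ∈ Q) : F z = z.1 := by
    by_cases hP : ρ z ∈ P
    · exact (if_pos hP).trans (heq _ _ (le_ρ z) (ρ_le z) ⟨hP, hz⟩)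
    · exact if_neg hP
  have hF : Continuous F := by
    rw [← continuousOn_univ, ← eq_univ_of_forall
      (s := ρ ⁻¹' P ∪ ρ ⁻¹' Q) fun z => hPQ.cover _ _ (le_ρ z) (ρ_le z)]
    refine .union_of_isClosed ?_ ?_ (hPQ.isClosed_left.preimage hρ) (hPQ.isClosed_right.preimage hρ)
    · refine Continuous.continuousOn (f := fun z => (φ (ρ z) : UnitAddCircle)) ?_ |>.congr
        fun z hz => if_pos hz
      exact (AddCircle.continuous_mk' 1).comp (hφ.comp hρ)
    · exact ((AddCircle.continuous_mk' 1).comp continuous_fst).continuousOn.congr F_of_right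
  have hFper (x y) : F (x + 1, y + 1) = F (x, y) := by
    simp [F, ρ_add_one, hPQ.isDiagPeriodic_left _ _, hφ']
  have := lift_sub_lift_eq_of_periodic (F := ⟨F, hF⟩) hFper (ψ₀ := fun x => φ (x, x))
    (ψ₁ := fun x => x) (by fun_prop) continuous_id
    (fun x => by simp [F, ρ, hPQ.bottom_mem])
    (fun x => by simpa using (F_of_right (x, x + 1) (by simpa [ρ] using hPQ.top_mem x)).symm)
  have := hφ' 0 0
  norm_num at *
  linarith

/-! ### Zeros of a function of two variables -/

/-- `s` is the only zero of `h` on `[a, b]`, and `h` changes sign there from negative to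
positive. -/
structure IsUpcrossing (h : ℝ → ℝ) (a b s : ℝ) : Prop where
  mem_Icc : s ∈ Icc a b
  eq_zero : h s = 0
  neg : ∀ y ∈ Ico a s, h y < 0
  pos : ∀ y ∈ Ioc s b, 0 < h y

namespace IsUpcrossing

variable {h : ℝ → ℝ} {a b s y : ℝ}

theorem le_of_nonneg (hs : IsUpcrossing h a b s) (hy : a ≤ y) (hy0 : 0 ≤ h y) : s ≤ y :=
  not_lt.1 fun hlt => (hs.neg y ⟨hy, hlt⟩).not_ge hy0

theorem eq_of_eq_zero (hs : IsUpcrossing h a b s) (hy : y ∈ Icc a b) (hy0 : h y = 0) : y = s :=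
  ((hs.le_of_nonneg hy.1 hy0.ge).eq_or_lt.resolve_right
    fun hlt => (hs.pos y ⟨hlt, hy.2⟩).ne' hy0).symm

theorem continuousOn {X : Type*} [TopologicalSpace X] {f : X → ℝ → ℝ} {J : Set X} {s : X → ℝ}
    (hf : ∀ y, Continuous fun x => f x y) (hs : ∀ x ∈ J, IsUpcrossing (f x) a b (s x)) :
    ContinuousOn s J := by
  intro x₁ hx₁
  obtain ⟨ha₁, hb₁⟩ := (hs x₁ hx₁).mem_Icc
  rw [ContinuousWithinAt, tendsto_order]
  constructor
  · intro c hc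
    obtain hca | hac := lt_or_ge c a
    · filter_upwards [self_mem_nhdsWithin] with x hx using hca.trans_le (hs x hx).mem_Icc.1
    obtain ⟨d, hcd, hd⟩ := exists_between hc
    have hneg : ∀ᶠ x in 𝓝[J] x₁, f x d < 0 := nhdsWithin_le_nhds <|
      (hf d).continuousAt.eventually_lt_const ((hs x₁ hx₁).neg d ⟨hac.trans hcd.le, hd⟩)
    filter_upwards [self_mem_nhdsWithin, hneg] with x hx hxd
    by_contra! hle
    exact hxd.not_gt ((hs x hx).pos d ⟨hle.trans_lt hcd, hd.le.trans hb₁⟩)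
  · intro c hc
    obtain hbc | hcb := lt_or_ge b c
    · filter_upwards [self_mem_nhdsWithin] with x hx using (hs x hx).mem_Icc.2.trans_lt hbc
    obtain ⟨d, hd, hdc⟩ := exists_between hc
    have hpos : ∀ᶠ x in 𝓝[J] x₁, 0 < f x d := nhdsWithin_le_nhds <|
      (hf d).continuousAt.eventually_const_lt ((hs x₁ hx₁).pos d ⟨hd, hdc.le.trans hcb⟩)
    filter_upwards [self_mem_nhdsWithin, hpos] with x hx hxd
    by_contra! hle
    exact hxd.not_gt ((hs x hx).neg d ⟨ha₁.trans hd.le, hdc.trans_le hle⟩)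

end IsUpcrossing

theorem exists_isUpcrossing {h : ℝ → ℝ} {a b : ℝ} (hab : a ≤ b) (hh : ContinuousOn h (Icc a b))
    (ha : h a < 0) (hb : 0 < h b)
    (hpos : ∀ y ∈ Icc a b, 0 ≤ h y → ∀ z ∈ Ioc y b, 0 < h z) : ∃ s, IsUpcrossing h a b s := by
  obtain ⟨s, hs, hs0⟩ := intermediate_value_Icc hab hh ⟨ha.le, hb.le⟩
  refine ⟨s, hs, hs0, fun y hy => ?_, hpos s hs hs0.ge⟩
  by_contra! hy0
  exact (hpos y ⟨hy.1, hy.2.le.trans hs.2⟩ hy0 s ⟨hy.2, hs.2⟩).ne' hs0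

theorem exists_isUpcrossing_of_strictConcaveOn {h h' : ℝ → ℝ} {a b c : ℝ}
    (hc : StrictConcaveOn ℝ (Icc a c) h) (hd : ∀ y, HasDerivAt h (h' y) y) (hab : a ≤ b)
    (hbc : b ≤ c) (ha : h a < 0) (hb : 0 < h b) :
    ∃ s, IsUpcrossing h a b s ∧ 0 < h' s ∧ ∀ y ∈ Icc a c, h y = 0 → 0 < h' y → y = s := by
  have hbac : b ∈ Icc a c := ⟨hab, hbc⟩
  obtain ⟨s, hs⟩ := exists_isUpcrossing hab (fun y _ => (hd y).continuousAt.continuousWithinAt)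
    ha hb fun y hy hy0 z hz => by
      obtain hzb | rfl := hz.2.lt_or_eq
      · have hyb := hz.1.trans hzb
        exact (le_min hy0 hb.le).trans_lt (hc.lt_on_openSegment ⟨hy.1, hy.2.trans hbc⟩ hbac hyb.ne
          (openSegment_eq_Ioo hyb ▸ ⟨hz.1, hzb⟩))
      · exact hb
  have hsb : s < b := hs.mem_Icc.2.lt_of_ne fun h => (h ▸ hb).ne' hs.eq_zero
  refine ⟨s, hs, ?_, fun y hy hy0 hy' => hs.eq_of_eq_zero ⟨hy.1, ?_⟩ hy0⟩
  · refine lt_trans ?_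
      (hc.slope_lt_of_hasDerivAt ⟨hs.mem_Icc.1, hsb.le.trans hbc⟩ hbac hsb (hd s))
    rw [slope_def_field, hs.eq_zero, sub_zero]
    exact div_pos hb (sub_pos.2 hsb)
  · by_contra! hby
    have := hc.lt_slope_of_hasDerivAt hbac hy hby (hd y)
    rw [slope_def_field, hy0, zero_sub, lt_div_iff₀ (sub_pos.2 hby)] at this
    linarith [mul_pos hy' (sub_pos.2 hby)]

theorem exists_forall_Icc_of_eventually {p : ℝ × ℝ → Prop} {x₀ y₀ : ℝ}
    (h : ∀ᶠ z in 𝓝 (x₀, y₀), p z) :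
    ∃ r > 0, ∀ x ∈ Icc (x₀ - r) (x₀ + r), ∀ y ∈ Icc (y₀ - r) (y₀ + r), p (x, y) := by
  obtain ⟨r, hr, hp⟩ := Metric.nhds_basis_closedBall.eventually_iff.1 h
  simp only [← closedBall_prod_same, Real.closedBall_eq_Icc] at hp
  exact ⟨r, hr, fun x hx y hy => hp ⟨hx, hy⟩⟩

theorem strictMonoOn_Icc_of_hasDerivAt_pos {f f' : ℝ → ℝ} (hf : ∀ y, HasDerivAt f (f' y) y)
    {a b : ℝ} (h : ∀ y ∈ Icc a b, 0 < f' y) : StrictMonoOn f (Icc a b) :=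
  strictMonoOn_of_deriv_pos (convex_Icc a b) (fun y _ => (hf y).continuousAt.continuousWithinAt)
    fun y hy => (hf y).deriv ▸ h y (interior_subset hy)

theorem strictConcaveOn_Icc_of_hasDerivAt_neg {f f' f'' : ℝ → ℝ} (hf : ∀ y, HasDerivAt f (f' y) y)
    (hf' : ∀ y, HasDerivAt f' (f'' y) y) {a b : ℝ} (h : ∀ y ∈ Icc a b, f'' y < 0) :
    StrictConcaveOn ℝ (Icc a b) f := by
  refine strictConcaveOn_of_deriv2_neg' (convex_Icc a b)
    (fun y _ => (hf y).continuousAt.continuousWithinAt) fun y hy => ?_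
  rw [Function.iterate_succ, Function.iterate_one, Function.comp_apply,
    funext fun y => (hf y).deriv, (hf' y).deriv]
  exact h y hy

/-- A punctured one-sided neighbourhood of `x`, on either side. -/
def IsHalfNhd (x : ℝ) (J : Set ℝ) : Prop :=
  ∃ δ > 0, J = Ioo x (x + δ) ∨ J = Ioo (x - δ) x

theorem IsHalfNhd.notMem {x : ℝ} {J : Set ℝ} (hJ : IsHalfNhd x J) : x ∉ J := by
  obtain ⟨δ, -, rfl | rfl⟩ := hJ
  exacts [left_notMem_Ioo, right_notMem_Ioo]

theorem IsHalfNhd.eventually_mem_of_mem {x : ℝ} {J J' : Set ℝ} (hJ : IsHalfNhd x J)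
    (hJ' : IsHalfNhd x J') (hne : (J ∩ J').Nonempty) : ∀ᶠ t in 𝓝 x, t ∈ J' → t ∈ J := by
  obtain ⟨u, hu, hu'⟩ := hne
  obtain ⟨δ, hδ, hJ⟩ := hJ
  obtain ⟨δ', -, hJ'⟩ := hJ'
  filter_upwards [Ioo_mem_nhds (sub_lt_self x hδ) (lt_add_of_pos_right x hδ)] with t ht ht'
  obtain rfl | rfl := hJ <;> obtain rfl | rfl := hJ'
  exacts [⟨ht'.1, ht.2⟩, (hu.1.not_gt hu'.2).elim, (hu.2.not_gt hu'.1).elim, ⟨ht.1, ht'.2⟩]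

theorem IsHalfNhd.neg {x : ℝ} {J : Set ℝ} (hJ : IsHalfNhd (-x) J) : IsHalfNhd x (-J) := by
  obtain ⟨δ, hδ, rfl | rfl⟩ := hJ
  · exact ⟨δ, hδ, .inr (by simp [← sub_eq_add_neg, add_comm])⟩
  · exact ⟨δ, hδ, .inl (by simp [add_comm])⟩

/-- The zeros of `f` near `(x₀, y₀)` at which `f` increases in the second variable form the graph
of `s` over `J`, and all points with `0 ≤ f` lie above that graph. The base point itself is not
required to be such a zero: at a fold it is the end point of the graph, and `x₀ ∉ J`. -/
structure IsZeroBranch (f fy : ℝ → ℝ → ℝ) (x₀ y₀ : ℝ) (J : Set ℝ) (s : ℝ → ℝ) : Prop where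
  base : s x₀ = y₀
  lineMap_mem : ∀ x ∈ insert x₀ J, ∀ x' ∈ J, ∀ t ∈ Ioc (0 : ℝ) 1, AffineMap.lineMap x x' t ∈ J
  continuousOn : ContinuousOn s (insert x₀ J)
  zero : ∀ x ∈ J, f x (s x) = 0 ∧ 0 < fy x (s x)
  mem_of_nonneg : ∀ᶠ z in 𝓝 (x₀, y₀), 0 ≤ f z.1 z.2 → z = (x₀, y₀) ∨ z.1 ∈ J
  le_of_nonneg : ∀ᶠ z in 𝓝 (x₀, y₀), z.1 ∈ J → 0 ≤ f z.1 z.2 → s z.1 ≤ z.2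
  mem_and_eq_of_zero : ∀ᶠ z in 𝓝 (x₀, y₀),
    f z.1 z.2 = 0 → 0 < fy z.1 z.2 → z.1 ∈ J ∧ s z.1 = z.2

theorem IsZeroBranch.eventually_mem {f fy : ℝ → ℝ → ℝ} {x₀ y₀ : ℝ} {J : Set ℝ} {s : ℝ → ℝ}
    (h : IsZeroBranch f fy x₀ y₀ J s) {U : Set (ℝ × ℝ)} (hU : U ∈ 𝓝 (x₀, y₀)) :
    ∀ᶠ x in 𝓝 x₀, x ∈ insert x₀ J → (x, s x) ∈ U := by
  have hc : ContinuousOn (fun x => (x, s x)) (insert x₀ J) := continuousOn_id.prodMk h.continuousOn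
  exact eventually_nhdsWithin_iff.1 (hc x₀ (mem_insert _ _) (by simpa only [h.base] using hU))

section ZeroBranch

variable {f fx fy fyy : ℝ → ℝ → ℝ} {x₀ y₀ : ℝ} {J : Set ℝ} {s : ℝ → ℝ}

theorem exists_isZeroBranch_of_pos (hf : Continuous fun z : ℝ × ℝ => f z.1 z.2)
    (hfy : Continuous fun z : ℝ × ℝ => fy z.1 z.2) (hd : ∀ x y, HasDerivAt (f x) (fy x y) y)
    (h0 : f x₀ y₀ = 0) (h1 : 0 < fy x₀ y₀) :
    ∃ J ∈ 𝓝 x₀, ∃ s, IsZeroBranch f fy x₀ y₀ J s := by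
  obtain ⟨r, hr, hpos⟩ := exists_forall_Icc_of_eventually
    ((hfy.tendsto (x₀, y₀)).eventually_const_lt h1)
  have mono (x) (hx : x ∈ Icc (x₀ - r) (x₀ + r)) : StrictMonoOn (f x) (Icc (y₀ - r) (y₀ + r)) :=
    strictMonoOn_Icc_of_hasDerivAt_pos (hd x) (hpos x hx)
  have hfx (y) : Continuous fun x => f x y :=
    hf.comp (f := fun x => (x, y)) (by fun_prop)
  have hy₀ : y₀ ∈ Icc (y₀ - r) (y₀ + r) := ⟨by linarith, by linarith⟩
  have hx₀ := mono x₀ ⟨by linarith, by linarith⟩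
  obtain ⟨δ, hδ, hball⟩ := Metric.eventually_nhds_iff_ball.1 <|
    ((hfx (y₀ - r)).continuousAt.eventually_lt_const
      (h0 ▸ hx₀ ⟨le_rfl, by linarith⟩ hy₀ (by linarith))).and <|
    ((hfx (y₀ + r)).continuousAt.eventually_const_lt
      (h0 ▸ hx₀ hy₀ ⟨by linarith, le_rfl⟩ (by linarith))).and <|
    Icc_mem_nhds (by linarith : x₀ - r < x₀) (by linarith : x₀ < x₀ + r)
  have hex : ∀ x ∈ Metric.ball x₀ δ, ∃ s, IsUpcrossing (f x) (y₀ - r) (y₀ + r) s := by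
    intro x hx
    obtain ⟨hlo, hhi, hxr⟩ := hball x hx
    exact exists_isUpcrossing (by linarith)
      (fun y _ => (hd x y).continuousAt.continuousWithinAt) hlo hhi fun y hy hy0 z hz =>
        hy0.trans_lt (mono x hxr hy ⟨hy.1.trans hz.1.le, hz.2⟩ hz.1)
  choose! s hs using hex
  have hx₀J := Metric.mem_ball_self (x := x₀) hδ
  have hbox : ∀ᶠ z in 𝓝 (x₀, y₀), z.2 ∈ Icc (y₀ - r) (y₀ + r) :=
    continuous_snd.tendsto (x₀, y₀) (Icc_mem_nhds (by linarith) (by linarith))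
  have hball_mem : ∀ᶠ z : ℝ × ℝ in 𝓝 (x₀, y₀), z.1 ∈ Metric.ball x₀ δ :=
    continuous_fst.tendsto (x₀, y₀) (Metric.ball_mem_nhds x₀ hδ)
  have hinsert := insert_eq_of_mem hx₀J
  refine ⟨_, Metric.ball_mem_nhds x₀ hδ, s,
    { base := ((hs x₀ hx₀J).eq_of_eq_zero hy₀ h0).symm
      lineMap_mem x hx x' hx' t ht :=
        (convex_ball x₀ δ).lineMap_mem (hinsert ▸ hx) hx' (Ioc_subset_Icc_self ht)
      continuousOn := hinsert.symm ▸ IsUpcrossing.continuousOn hfx hs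
      zero x hx := ⟨(hs x hx).eq_zero, hpos x (hball x hx).2.2 _ (hs x hx).mem_Icc⟩
      mem_of_nonneg := hball_mem.mono fun z hz _ => .inr hz
      le_of_nonneg := hbox.mono fun z hz hzJ => (hs _ hzJ).le_of_nonneg hz.1
      mem_and_eq_of_zero := ?_ }⟩
  filter_upwards [hbox, hball_mem] with z hz hzJ hz0 _
  exact ⟨hzJ, ((hs _ hzJ).eq_of_eq_zero hz hz0).symm⟩

theorem neg_of_strictConcaveOn_of_hasDerivAt_zero {h : ℝ → ℝ} {S : Set ℝ} {c y : ℝ}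
    (hc : StrictConcaveOn ℝ S h) (hd : HasDerivAt h 0 c) (hc0 : h c = 0) (hcS : c ∈ S)
    (hy : y ∈ S) (hne : y ≠ c) : h y < 0 := by
  obtain hlt | hlt := hne.lt_or_gt
  · have := hc.lt_slope_of_hasDerivAt hy hcS hlt hd
    rw [slope_def_field, hc0, lt_div_iff₀ (sub_pos.2 hlt)] at this
    linarith
  · have := hc.slope_lt_of_hasDerivAt hcS hy hlt hd
    rw [slope_def_field, hc0, div_lt_iff₀ (sub_pos.2 hlt)] at this
    linarith

theorem exists_box_of_fold (hf : Continuous fun z : ℝ × ℝ => f z.1 z.2)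
    (hfx : Continuous fun z : ℝ × ℝ => fx z.1 z.2)
    (hfyy : Continuous fun z : ℝ × ℝ => fyy z.1 z.2)
    (hdx : ∀ x y, HasDerivAt (fun x => f x y) (fx x y) x)
    (hdy : ∀ x y, HasDerivAt (f x) (fy x y) y) (hdyy : ∀ x y, HasDerivAt (fy x) (fyy x y) y)
    (h0 : f x₀ y₀ = 0) (hy : fy x₀ y₀ = 0) (hx : 0 < fx x₀ y₀) (hyy : fyy x₀ y₀ < 0) :
    ∃ r > 0, ∃ δ > 0,
      (∀ x ∈ Ioo (x₀ - δ) (x₀ + δ),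
        StrictConcaveOn ℝ (Icc (y₀ - r) (y₀ + r)) (f x) ∧ f x (y₀ - r) < 0) ∧
      (∀ x ∈ Ioo x₀ (x₀ + δ), 0 < f x y₀) ∧
      (∀ y ∈ Icc (y₀ - r) (y₀ + r), y ≠ y₀ → f x₀ y < 0) ∧
      ∀ x ∈ Ioo (x₀ - δ) x₀, ∀ y ∈ Icc (y₀ - r) (y₀ + r), f x y < 0 := by
  obtain ⟨r, hr, hbox⟩ := exists_forall_Icc_of_eventually
    (((hfx.tendsto (x₀, y₀)).eventually_const_lt hx).and
      ((hfyy.tendsto (x₀, y₀)).eventually_lt_const hyy))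
  have concave (x) (hx : x ∈ Icc (x₀ - r) (x₀ + r)) :
      StrictConcaveOn ℝ (Icc (y₀ - r) (y₀ + r)) (f x) :=
    strictConcaveOn_Icc_of_hasDerivAt_neg (hdy x) (hdyy x) fun y hy => (hbox x hx y hy).2
  have mono (y) (hy : y ∈ Icc (y₀ - r) (y₀ + r)) :
      StrictMonoOn (fun x => f x y) (Icc (x₀ - r) (x₀ + r)) :=
    strictMonoOn_Icc_of_hasDerivAt_pos (fun x => hdx x y) fun x hx => (hbox x hx y hy).1
  have hx₀ : x₀ ∈ Icc (x₀ - r) (x₀ + r) := ⟨by linarith, by linarith⟩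
  have hy₀ : y₀ ∈ Icc (y₀ - r) (y₀ + r) := ⟨by linarith, by linarith⟩
  have neg_base (y) (hyr : y ∈ Icc (y₀ - r) (y₀ + r)) (hne : y ≠ y₀) : f x₀ y < 0 :=
    neg_of_strictConcaveOn_of_hasDerivAt_zero (concave x₀ hx₀) (hy ▸ hdy x₀ y₀) h0 hy₀ hyr hne
  have hfx' : Continuous fun x => f x (y₀ - r) :=
    hf.comp (f := fun x => (x, y₀ - r)) (by fun_prop)
  obtain ⟨δ, hδ, hball⟩ := Metric.eventually_nhds_iff_ball.1 <|
    (hfx'.continuousAt.eventually_lt_const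
      (neg_base (y₀ - r) ⟨le_rfl, by linarith⟩ (by linarith))).and <|
    Icc_mem_nhds (by linarith : x₀ - r < x₀) (by linarith : x₀ < x₀ + r)
  simp only [Real.ball_eq_Ioo] at hball
  refine ⟨r, hr, δ, hδ, fun x hx => ⟨concave x (hball x hx).2, (hball x hx).1⟩, fun x hx => ?_,
    neg_base, fun x hx y hyr => ?_⟩
  · exact h0.symm.trans_lt (mono y₀ hy₀ hx₀ (hball x ⟨by linarith [hx.1], hx.2⟩).2 hx.1)
  · refine (mono y hyr (hball x ⟨hx.1, by linarith [hx.2]⟩).2 hx₀ hx.2).trans_le ?_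
    obtain rfl | hne := eq_or_ne y y₀
    exacts [h0.le, (neg_base y hyr hne).le]

theorem exists_isZeroBranch_of_fold_pos (hf : Continuous fun z : ℝ × ℝ => f z.1 z.2)
    (hfx : Continuous fun z : ℝ × ℝ => fx z.1 z.2)
    (hfyy : Continuous fun z : ℝ × ℝ => fyy z.1 z.2)
    (hdx : ∀ x y, HasDerivAt (fun x => f x y) (fx x y) x)
    (hdy : ∀ x y, HasDerivAt (f x) (fy x y) y) (hdyy : ∀ x y, HasDerivAt (fy x) (fyy x y) y)
    (h0 : f x₀ y₀ = 0) (hy : fy x₀ y₀ = 0) (hx : 0 < fx x₀ y₀) (hyy : fyy x₀ y₀ < 0) :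
    ∃ J s, IsHalfNhd x₀ J ∧ IsZeroBranch f fy x₀ y₀ J s := by
  obtain ⟨r, hr, δ, hδ, hconc, hpos, hbase, hleft⟩ :=
    exists_box_of_fold hf hfx hfyy hdx hdy hdyy h0 hy hx hyy
  have hcross : ∀ x ∈ Ico x₀ (x₀ + δ), ∃ s, IsUpcrossing (f x) (y₀ - r) y₀ s ∧ (x₀ < x →
      0 < fy x s ∧ ∀ y ∈ Icc (y₀ - r) (y₀ + r), f x y = 0 → 0 < fy x y → y = s) := by
    intro x hx
    obtain rfl | hlt := hx.1.eq_or_lt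
    · exact ⟨y₀, ⟨⟨by linarith, le_rfl⟩, h0,
        fun y hy => hbase y ⟨hy.1, by linarith [hy.2]⟩ hy.2.ne, by simp⟩, by simp⟩
    · obtain ⟨hxc, hxr⟩ := hconc x ⟨by linarith, hx.2⟩
      obtain ⟨s, hs⟩ := exists_isUpcrossing_of_strictConcaveOn hxc (hdy x) (by linarith)
        (by linarith) hxr (hpos x ⟨hlt, hx.2⟩)
      exact ⟨s, hs.1, fun _ => hs.2⟩
  choose! s hs using hcross
  have hJ (x) (hx : x ∈ Ioo x₀ (x₀ + δ)) := hs x ⟨hx.1.le, hx.2⟩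
  have hbox : ∀ᶠ z in 𝓝 (x₀, y₀), z ∈ Ioo (x₀ - δ) (x₀ + δ) ×ˢ Icc (y₀ - r) (y₀ + r) :=
    prod_mem_nhds (Ioo_mem_nhds (by linarith) (by linarith))
      (Icc_mem_nhds (by linarith) (by linarith))
  have mem_of_nonneg (z) (hz : z ∈ Ioo (x₀ - δ) (x₀ + δ) ×ˢ Icc (y₀ - r) (y₀ + r))
      (hz0 : 0 ≤ f z.1 z.2) : z = (x₀, y₀) ∨ z.1 ∈ Ioo x₀ (x₀ + δ) := by
    obtain hlt | heq | hgt := lt_trichotomy z.1 x₀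
    · exact absurd hz0 (hleft _ ⟨hz.1.1, hlt⟩ _ hz.2).not_ge
    · refine .inl (Prod.ext heq ?_)
      by_contra hne
      exact (heq ▸ hbase z.2 hz.2 hne).not_ge hz0
    · exact .inr ⟨hgt, hz.1.2⟩
  have hinsert := Ioo_insert_left (by linarith : x₀ < x₀ + δ)
  refine ⟨Ioo x₀ (x₀ + δ), s, ⟨δ, hδ, .inl rfl⟩,
    { base := ((hs x₀ ⟨le_rfl, by linarith⟩).1.eq_of_eq_zero ⟨by linarith, le_rfl⟩ h0).symm
      lineMap_mem x hx x' hx' t ht := ?_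
      continuousOn := hinsert ▸ IsUpcrossing.continuousOn
        (fun y => hf.comp (f := fun x => (x, y)) (by fun_prop)) fun x hx => (hs x hx).1
      zero x hx := ⟨(hJ x hx).1.eq_zero, ((hJ x hx).2 hx.1).1⟩
      mem_of_nonneg := hbox.mono mem_of_nonneg
      le_of_nonneg := hbox.mono fun z hz hzJ => (hJ _ hzJ).1.le_of_nonneg hz.2.1
      mem_and_eq_of_zero := ?_ }⟩
  · rw [hinsert] at hx
    rw [AffineMap.lineMap_apply_ring']
    constructor <;> nlinarith [hx.1, hx.2, hx'.1, hx'.2, ht.1, ht.2]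
  · filter_upwards [hbox] with z hz hz0 hzy
    have hzJ := (mem_of_nonneg z hz hz0.ge).resolve_left fun h => hzy.ne' (h ▸ hy)
    exact ⟨hzJ, (((hJ _ hzJ).2 hzJ.1).2 _ hz.2 hz0 hzy).symm⟩

theorem tendsto_neg_fst (x₀ y₀ : ℝ) :
    Tendsto (fun z : ℝ × ℝ => (-z.1, z.2)) (𝓝 (x₀, y₀)) (𝓝 (-x₀, y₀)) :=
  Continuous.tendsto (by fun_prop) (x₀, y₀)

theorem IsZeroBranch.neg_fst (h : IsZeroBranch (fun x => f (-x)) (fun x => fy (-x)) (-x₀) y₀ J s) :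
    IsZeroBranch f fy x₀ y₀ (-J) (fun x => s (-x)) where
  base := h.base
  lineMap_mem x hx x' hx' t ht := by
    have := h.lineMap_mem (-x) (by simpa [neg_eq_iff_eq_neg] using hx) (-x') hx' t ht
    rw [AffineMap.lineMap_apply_ring] at this ⊢
    rw [Set.mem_neg]
    convert this using 1
    ring
  continuousOn := by
    refine h.continuousOn.comp continuous_neg.continuousOn fun x hx => ?_
    simpa [neg_eq_iff_eq_neg] using hx
  zero x hx := by simpa using h.zero (-x) hx
  mem_of_nonneg := by
    filter_upwards [(tendsto_neg_fst x₀ y₀).eventually h.mem_of_nonneg] with z hz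
    simpa [Prod.ext_iff] using hz
  le_of_nonneg := by
    filter_upwards [(tendsto_neg_fst x₀ y₀).eventually h.le_of_nonneg] with z hz
    simpa using hz
  mem_and_eq_of_zero := by
    filter_upwards [(tendsto_neg_fst x₀ y₀).eventually h.mem_and_eq_of_zero] with z hz
    simpa using hz

theorem exists_isZeroBranch_of_fold (hf : Continuous fun z : ℝ × ℝ => f z.1 z.2)
    (hfx : Continuous fun z : ℝ × ℝ => fx z.1 z.2)
    (hfyy : Continuous fun z : ℝ × ℝ => fyy z.1 z.2)
    (hdx : ∀ x y, HasDerivAt (fun x => f x y) (fx x y) x)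
    (hdy : ∀ x y, HasDerivAt (f x) (fy x y) y) (hdyy : ∀ x y, HasDerivAt (fy x) (fyy x y) y)
    (h0 : f x₀ y₀ = 0) (hy : fy x₀ y₀ = 0) (hx : fx x₀ y₀ ≠ 0) (hyy : fyy x₀ y₀ < 0) :
    ∃ J s, IsHalfNhd x₀ J ∧ IsZeroBranch f fy x₀ y₀ J s := by
  obtain hneg | hpos := hx.lt_or_gt
  · have hc : Continuous fun z : ℝ × ℝ => (-z.1, z.2) := by fun_prop
    obtain ⟨J, s, hJ, h⟩ := exists_isZeroBranch_of_fold_pos (f := fun x => f (-x))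
      (fx := fun x y => -fx (-x) y) (fy := fun x => fy (-x)) (fyy := fun x => fyy (-x))
      (x₀ := -x₀) (y₀ := y₀) (hf.comp hc) (hfx.comp hc).neg (hfyy.comp hc)
      (fun x y => by simpa [Function.comp_def] using (hdx (-x) y).comp x (hasDerivAt_neg x))
      (fun x y => hdy (-x) y) (fun x y => hdyy (-x) y) (by simpa) (by simpa) (by simpa) (by simpa)
    exact ⟨-J, _, hJ.neg, h.neg_fst⟩
  · exact exists_isZeroBranch_of_fold_pos hf hfx hfyy hdx hdy hdyy h0 hy hpos hyy

theorem IsZeroBranch.exists_path (h : IsZeroBranch f fy x₀ y₀ J s) {U : Set (ℝ × ℝ)}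
    (hU : U ∈ 𝓝 (x₀, y₀)) :
    ∃ V ∈ 𝓝 (x₀, y₀), ∀ z ∈ V, ∀ z' ∈ V, z = (x₀, y₀) ∨ f z.1 z.2 = 0 ∧ 0 < fy z.1 z.2 →
      f z'.1 z'.2 = 0 → 0 < fy z'.1 z'.2 →
      ∃ w : Path z z', ∀ t, w t ∈ U ∧ (0 < t → f (w t).1 (w t).2 = 0 ∧ 0 < fy (w t).1 (w t).2) := by
  have hc : ContinuousOn (fun x => (x, s x)) (insert x₀ J) := continuousOn_id.prodMk h.continuousOn
  obtain ⟨ε, hε, hball⟩ := Metric.eventually_nhds_iff_ball.1 (h.eventually_mem hU)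
  refine ⟨_, inter_mem h.mem_and_eq_of_zero
    (continuous_fst.tendsto (x₀, y₀) (Metric.ball_mem_nhds x₀ hε)), ?_⟩
  rintro ⟨x, y⟩ ⟨hs, hx⟩ ⟨x', y'⟩ ⟨hs', hx'⟩ hz hz0 hzy
  obtain ⟨hxJ, rfl⟩ : x ∈ insert x₀ J ∧ s x = y := by
    rcases hz with hz | hz
    · obtain ⟨rfl, rfl⟩ := Prod.mk.inj hz
      exact ⟨mem_insert _ _, h.base⟩
    · exact (hs hz.1 hz.2).imp_left .inr
  obtain ⟨hxJ', rfl⟩ : x' ∈ J ∧ s x' = y' := hs' hz0 hzy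
  let ℓ (t : I) : ℝ := AffineMap.lineMap x x' (t : ℝ)
  have hℓJ (t : I) (ht : 0 < t) : ℓ t ∈ J := h.lineMap_mem _ hxJ _ hxJ' t ⟨ht, t.2.2⟩
  have hℓ (t : I) : ℓ t ∈ insert x₀ J := by
    obtain rfl | ht := (bot_le (a := t)).eq_or_lt
    · simpa [ℓ] using hxJ
    · exact mem_insert_of_mem _ (hℓJ t ht)
  refine ⟨⟨⟨fun t => (ℓ t, s (ℓ t)), hc.comp_continuous (f := ℓ) (by fun_prop) hℓ⟩, ?_, ?_⟩,
    fun t => ⟨hball _ ((convex_ball x₀ ε).lineMap_mem hx hx' t.2) (hℓ t),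
      fun ht => h.zero _ (hℓJ t ht)⟩⟩ <;> simp [ℓ]

theorem weaklyLocallyPathConnectedAt_zeros (hf : Continuous fun z : ℝ × ℝ => f z.1 z.2)
    (hfy : Continuous fun z : ℝ × ℝ => fy z.1 z.2) (hd : ∀ x y, HasDerivAt (f x) (fy x y) y)
    (h0 : f x₀ y₀ = 0) (h1 : fy x₀ y₀ ≠ 0) :
    WeaklyLocallyPathConnectedAt {z : ℝ × ℝ | f z.1 z.2 = 0} (x₀, y₀) := by
  wlog hpos : 0 < fy x₀ y₀ generalizing f fy
  · simpa using this (f := fun x y => -f x y) (fy := fun x y => -fy x y) hf.neg hfy.neg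
      (fun x y => (hd x y).neg) (by simpa using h0) (by simpa using h1)
      (by simpa using h1.lt_of_le (not_lt.1 hpos))
  intro U hU
  obtain ⟨J, -, s, hs⟩ := exists_isZeroBranch_of_pos hf hfy hd h0 hpos
  obtain ⟨V, hV, hpath⟩ := hs.exists_path hU
  refine eventually_nhdsWithin_iff.2 ?_
  filter_upwards [hV, (hfy.tendsto (x₀, y₀)).eventually_const_lt hpos] with z hz hzy hz0
  obtain ⟨w, hw⟩ := hpath _ (mem_of_mem_nhds hV) z hz (.inl rfl) hz0 hzy
  refine ⟨w, fun t => ⟨?_, (hw t).1⟩⟩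
  obtain rfl | ht := (bot_le (a := t)).eq_or_lt
  exacts [(congrArg (fun z : ℝ × ℝ => f z.1 z.2) w.source).trans h0, ((hw t).2 ht).1]

end ZeroBranch

/-! ### Attraction fields -/

/-- The lift of an attraction diagram to the plane: `g` lifts `∂E/∂y`, and the other functions
are its partial derivatives. The pivots are the points where `g` and `gy` vanish. -/
structure Attraction where
  (g gx gy gyy : ℝ → ℝ → ℝ)
  continuous_g : Continuous fun z : ℝ × ℝ => g z.1 z.2
  continuous_gx : Continuous fun z : ℝ × ℝ => gx z.1 z.2
  continuous_gy : Continuous fun z : ℝ × ℝ => gy z.1 z.2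
  continuous_gyy : Continuous fun z : ℝ × ℝ => gyy z.1 z.2
  hasDerivAt_gx : ∀ x y, HasDerivAt (fun x => g x y) (gx x y) x
  hasDerivAt_gy : ∀ x y, HasDerivAt (g x) (gy x y) y
  hasDerivAt_gyy : ∀ x y, HasDerivAt (gy x) (gyy x y) y
  add_one_left : ∀ x y, g (x + 1) y = g x y
  add_one_right : ∀ x y, g x (y + 1) = g x y
  diag : ∀ x, g x x = 0
  gy_diag_pos : ∀ x, 0 < gy x x
  gx_ne_zero : ∀ x y, g x y = 0 → gy x y = 0 → gx x y ≠ 0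
  gyy_ne_zero : ∀ x y, g x y = 0 → gy x y = 0 → gyy x y ≠ 0

namespace Attraction

variable (D : Attraction) {x y w : ℝ}

/-- Lift of a stable configuration, the diagonal included. -/
def Stable (x y : ℝ) : Prop := D.g x y = 0 ∧ 0 < D.gy x y

/-- Lift of a forward pivot configuration. -/
def ForwardPivot (x y : ℝ) : Prop := D.g x y = 0 ∧ D.gy x y = 0 ∧ D.gyy x y < 0

/-- Lift of a backward pivot configuration. -/
def BackwardPivot (x y : ℝ) : Prop := D.g x y = 0 ∧ D.gy x y = 0 ∧ 0 < D.gyy x y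

/-- Lift of a configuration that a forward run passes through. -/
def RunsForward (x y : ℝ) : Prop := D.g x y < 0 ∨ D.ForwardPivot x y

/-- Lift of a configuration that a backward run passes through. -/
def RunsBackward (x y : ℝ) : Prop := 0 < D.g x y ∨ D.BackwardPivot x y

/-- Lift of a forward run: on the vertical line over `x`, from height `y` to height `w`. -/
def ForwardRun (x y w : ℝ) : Prop :=
  y < w ∧ D.Stable x w ∧ ∀ t ∈ Ioo y w, D.RunsForward x t

/-- Lift of a backward run: on the vertical line over `x`, from height `y` down to height `w`. -/
def BackwardRun (x y w : ℝ) : Prop :=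
  w < y ∧ D.Stable x w ∧ ∀ t ∈ Ioo w y, D.RunsBackward x t

theorem gy_add_one_right (x y : ℝ) : D.gy x (y + 1) = D.gy x y := by
  have h := (D.hasDerivAt_gy x (y + 1)).comp_add_const y 1
  simp only [D.add_one_right] at h
  exact h.unique (D.hasDerivAt_gy x y)

theorem g_add_int (x y : ℝ) (m n : ℤ) : D.g (x + m) (y + n) = D.g x y := by
  have hx : Function.Periodic (fun x => D.g x (y + n)) 1 := fun x => D.add_one_left x _
  have hy : Function.Periodic (D.g x) 1 := D.add_one_right x
  simpa only [mul_one] using (hx.int_mul m x).trans (by simpa only [mul_one] using hy.int_mul n y)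

/-- The attraction field of the track traversed in the opposite direction. -/
def reflect : Attraction where
  g x y := -D.g (-x) (1 - y)
  gx x y := D.gx (-x) (1 - y)
  gy x y := D.gy (-x) (1 - y)
  gyy x y := -D.gyy (-x) (1 - y)
  continuous_g := (D.continuous_g.comp
    (by fun_prop : Continuous fun z : ℝ × ℝ => (-z.1, 1 - z.2))).neg
  continuous_gx := D.continuous_gx.comp (by fun_prop : Continuous fun z : ℝ × ℝ => (-z.1, 1 - z.2))
  continuous_gy := D.continuous_gy.comp (by fun_prop : Continuous fun z : ℝ × ℝ => (-z.1, 1 - z.2))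
  continuous_gyy := (D.continuous_gyy.comp
    (by fun_prop : Continuous fun z : ℝ × ℝ => (-z.1, 1 - z.2))).neg
  hasDerivAt_gx x y := by
    simpa [Function.comp_def] using
      ((D.hasDerivAt_gx (-x) (1 - y)).comp x (hasDerivAt_neg x)).fun_neg
  hasDerivAt_gy x y := by
    simpa using ((D.hasDerivAt_gy (-x) (1 - y)).comp_const_sub 1 y).fun_neg
  hasDerivAt_gyy x y := (D.hasDerivAt_gyy (-x) (1 - y)).comp_const_sub 1 y
  add_one_left x y := by rw [← D.add_one_left (-(x + 1))]; ring_nf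
  add_one_right x y := by rw [← D.add_one_right _ (1 - (y + 1))]; ring_nf
  diag x := by rw [sub_eq_neg_add, D.add_one_right, D.diag, neg_zero]
  gy_diag_pos x := by rw [sub_eq_neg_add, D.gy_add_one_right]; exact D.gy_diag_pos _
  gx_ne_zero x y h h' := D.gx_ne_zero _ _ (neg_eq_zero.1 h) h'
  gyy_ne_zero x y h h' := neg_ne_zero.2 (D.gyy_ne_zero _ _ (neg_eq_zero.1 h) h')

theorem reflect_g : D.reflect.g x y = -D.g (-x) (1 - y) := rfl

theorem reflect_stable : D.reflect.Stable x y ↔ D.Stable (-x) (1 - y) :=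
  and_congr_left' neg_eq_zero

theorem reflect_forwardPivot : D.reflect.ForwardPivot x y ↔ D.BackwardPivot (-x) (1 - y) :=
  and_congr neg_eq_zero (and_congr_right' neg_lt_zero)

theorem reflect_backwardPivot : D.reflect.BackwardPivot x y ↔ D.ForwardPivot (-x) (1 - y) :=
  and_congr neg_eq_zero (and_congr_right' neg_pos)

theorem reflect_runsForward : D.reflect.RunsForward x y ↔ D.RunsBackward (-x) (1 - y) :=
  or_congr neg_lt_zero D.reflect_forwardPivot

theorem reflect_runsBackward : D.reflect.RunsBackward x y ↔ D.RunsForward (-x) (1 - y) :=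
  or_congr neg_pos D.reflect_backwardPivot

theorem reflect_forwardRun :
    D.reflect.ForwardRun x y w ↔ D.BackwardRun (-x) (1 - y) (1 - w) := by
  refine and_congr (by simp) (and_congr D.reflect_stable
    ⟨fun h t ht => ?_, fun h t ht => D.reflect_runsForward.2 (h _ (by simpa using ht.symm))⟩)
  simpa using D.reflect_runsForward.1 (h (1 - t) ⟨by linarith [ht.2], by linarith [ht.1]⟩)

theorem reflect_backwardRun :
    D.reflect.BackwardRun x y w ↔ D.ForwardRun (-x) (1 - y) (1 - w) := by
  refine and_congr (by simp) (and_congr D.reflect_stable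
    ⟨fun h t ht => ?_, fun h t ht => D.reflect_runsBackward.2 (h _ (by simpa using ht.symm))⟩)
  simpa using D.reflect_runsBackward.1 (h (1 - t) ⟨by linarith [ht.2], by linarith [ht.1]⟩)

theorem exists_margin_above : ∃ ε > 0, ∀ x, ∀ y ∈ Ioo x (x + ε), 0 < D.g x y := by
  have hgy : ∀ᶠ u in 𝓝 (0 : ℝ), ∀ x ∈ Icc (0 : ℝ) 1, 0 < D.gy x (x + u) := by
    refine isCompact_Icc.eventually_forall_of_forall_eventually fun x _ => ?_
    have hc : Continuous fun z : ℝ × ℝ => D.gy z.2 (z.2 + z.1) :=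
      D.continuous_gy.comp (by fun_prop : Continuous fun z : ℝ × ℝ => (z.2, z.2 + z.1))
    exact hc.continuousAt.eventually_const_lt (by simpa using D.gy_diag_pos x)
  obtain ⟨ε, hε, hgy⟩ := Metric.eventually_nhds_iff.1 hgy
  refine ⟨ε, hε, fun x y hy => ?_⟩
  rw [← D.g_add_int x y (-⌊x⌋) (-⌊x⌋)]
  have hx : x + (-⌊x⌋ : ℤ) ∈ Icc (0 : ℝ) 1 := by
    push_cast
    constructor <;> linarith [Int.floor_le x, Int.lt_floor_add_one x]
  have hmono := strictMonoOn_Icc_of_hasDerivAt_pos (D.hasDerivAt_gy (x + (-⌊x⌋ : ℤ)))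
    (a := x + (-⌊x⌋ : ℤ)) (b := y + (-⌊x⌋ : ℤ)) fun t ht => by
      have := hgy (y := t - (x + (-⌊x⌋ : ℤ))) (by
        rw [Real.dist_eq, sub_zero, abs_lt]
        constructor <;> linarith [ht.1, ht.2, hy.1, hy.2]) _ hx
      rwa [add_sub_cancel] at this
  have hle : x + (-⌊x⌋ : ℤ) < y + (-⌊x⌋ : ℤ) := by linarith [hy.1]
  simpa only [D.diag] using hmono (left_mem_Icc.2 hle.le) (right_mem_Icc.2 hle.le) hle

theorem exists_margin : ∃ ε > 0, ∀ x y, (x < y → y < x + ε → 0 < D.g x y) ∧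
    (x + 1 - ε < y → y < x + 1 → D.g x y < 0) := by
  obtain ⟨ε, hε, h⟩ := D.exists_margin_above
  obtain ⟨ε', hε', h'⟩ := D.reflect.exists_margin_above
  refine ⟨min ε ε', lt_min hε hε', fun x y => ⟨fun h₁ h₂ => ?_, fun h₁ h₂ => ?_⟩⟩
  · exact h x y ⟨h₁, h₂.trans_le (by gcongr; exact min_le_left _ _)⟩
  · have := h' (-x) (1 - y) ⟨by linarith, by linarith [min_le_right ε ε']⟩
    simpa [reflect_g] using this

end Attraction

/-! ### Bands of zeros -/

/-- A fundamental domain, under the horizontal unit translation, of the configurations off the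
main diagonal; its two boundary lines lie over the main diagonal. -/
def openStrip : Set (ℝ × ℝ) := {z | z.1 < z.2 ∧ z.2 < z.1 + 1}

theorem isDiagPeriodic_openStrip : IsDiagPeriodic openStrip := fun x y => by
  simp [openStrip]

theorem isOpen_openStrip : IsOpen openStrip :=
  (isOpen_lt continuous_fst continuous_snd).inter
    (isOpen_lt continuous_snd (continuous_fst.add continuous_const))

namespace IsDiagPeriodic

variable {Y Y' : Set (ℝ × ℝ)} (hY : IsDiagPeriodic Y)

include hY

theorem mem_add_int (x y : ℝ) (n : ℤ) : (x + n, y + n) ∈ Y ↔ (x, y) ∈ Y := by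
  have hper : Function.Periodic (fun t : ℝ => (x + t, y + t) ∈ Y) 1 := fun t => by
    simpa [add_assoc] using hY (x + t) (y + t)
  simpa using hper.int_mul n 0

theorem sdiff (hY' : IsDiagPeriodic Y') : IsDiagPeriodic (Y \ Y') := fun x y =>
  and_congr (hY x y) (not_congr (hY' x y))

theorem inter (hY' : IsDiagPeriodic Y') : IsDiagPeriodic (Y ∩ Y') := fun x y =>
  and_congr (hY x y) (hY' x y)

theorem union (hY' : IsDiagPeriodic Y') : IsDiagPeriodic (Y ∪ Y') := fun x y =>
  or_congr (hY x y) (hY' x y)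

end IsDiagPeriodic

/-- The covering map from the plane to the configuration torus. -/
def toTorus (z : ℝ × ℝ) : Config := (z.1, z.2)

theorem continuous_toTorus : Continuous toTorus :=
  (AddCircle.continuous_mk' 1).prodMap (AddCircle.continuous_mk' 1)

theorem isOpenMap_toTorus : IsOpenMap toTorus :=
  QuotientAddGroup.isOpenMap_coe.prodMap QuotientAddGroup.isOpenMap_coe

theorem toTorus_eq_iff {x y x' y' : ℝ} :
    toTorus (x, y) = toTorus (x', y') ↔ ∃ m n : ℤ, x' = x + m ∧ y' = y + n := by
  simp only [toTorus, Prod.mk.injEq, coe_eq_coe_iff_exists_int, sub_eq_iff_eq_add',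
    exists_and_left, exists_and_right]

theorem toTorus_add_int (x y : ℝ) (m n : ℤ) : toTorus (x + m, y + n) = toTorus (x, y) :=
  (toTorus_eq_iff.2 ⟨m, n, rfl, rfl⟩).symm

theorem exists_toTorus (p : Config) : ∃ x y : ℝ, x ≤ y ∧ y < x + 1 ∧ toTorus (x, y) = p := by
  obtain ⟨x, hx⟩ : ∃ x : ℝ, (x : UnitAddCircle) = p.1 := QuotientAddGroup.mk_surjective _
  obtain ⟨y, hy⟩ : ∃ y : ℝ, (y : UnitAddCircle) = p.2 := QuotientAddGroup.mk_surjective _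
  refine ⟨x, x + Int.fract (y - x), by linarith [Int.fract_nonneg (y - x)],
    by linarith [Int.fract_lt_one (y - x)], ?_⟩
  rw [show p = toTorus (x, y) from Prod.ext hx.symm hy.symm]
  exact toTorus_eq_iff.2 ⟨0, ⌊y - x⌋, by simp, by linarith [Int.fract_add_floor (y - x)]⟩

theorem toTorus_mem_image_iff {Y : Set (ℝ × ℝ)} (hY : IsDiagPeriodic Y) (hYs : Y ⊆ openStrip)
    {z : ℝ × ℝ} (hz : z ∈ openStrip) : toTorus z ∈ toTorus '' Y ↔ z ∈ Y := by
  refine ⟨?_, mem_image_of_mem _⟩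
  rintro ⟨⟨x, y⟩, hxy, heq⟩
  obtain ⟨m, n, hm, hn⟩ := toTorus_eq_iff.1 heq
  obtain ⟨h₁, h₂⟩ := hYs hxy
  obtain ⟨h₃, h₄⟩ := hz
  have hlt : (n : ℝ) < m + 1 := by linarith
  have hgt : (m : ℝ) < n + 1 := by linarith
  have hmn : m = n := by norm_cast at hlt hgt; lia
  rw [← hY.mem_add_int x y n] at hxy
  rwa [show z = (x + n, y + n) from Prod.ext (hmn ▸ hm) hn]

theorem isClosed_image_toTorus {Y : Set (ℝ × ℝ)} (hYc : IsClosed Y) (hY : IsDiagPeriodic Y)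
    (hYs : Y ⊆ openStrip) : IsClosed (toTorus '' Y) := by
  have : toTorus '' Y = toTorus '' (Y ∩ Icc (0 : ℝ) 1 ×ˢ Icc (0 : ℝ) 2) := by
    refine subset_antisymm ?_ (image_mono inter_subset_left)
    rintro _ ⟨⟨x, y⟩, h, rfl⟩
    have h' : (x + (-⌊x⌋ : ℤ), y + (-⌊x⌋ : ℤ)) ∈ Y := (hY.mem_add_int _ _ _).2 h
    refine ⟨_, ⟨h', ?_⟩, toTorus_add_int _ _ _ _⟩
    have := hYs h
    simp only [openStrip, mem_ofPred_eq] at this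
    push_cast
    constructor <;> constructor <;> simp only <;>
      linarith [Int.floor_le x, Int.lt_floor_add_one x]
  rw [this]
  exact (((isCompact_Icc.prod isCompact_Icc).inter_left hYc).image continuous_toTorus).isClosed

theorem disjoint_image_toTorus {Y Y' : Set (ℝ × ℝ)} (hY : IsDiagPeriodic Y) (hYs : Y ⊆ openStrip)
    (hYs' : Y' ⊆ openStrip) (h : Disjoint Y Y') : Disjoint (toTorus '' Y) (toTorus '' Y') := by
  rw [disjoint_right]
  rintro _ ⟨z, hz, rfl⟩ hz'
  exact disjoint_right.1 h hz ((toTorus_mem_image_iff hY hYs (hYs' hz)).1 hz')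

theorem disjoint_image_toTorus_diagonal {Y : Set (ℝ × ℝ)} (hYs : Y ⊆ openStrip) :
    Disjoint (toTorus '' Y) (diagonal UnitAddCircle) := by
  rw [disjoint_left]
  rintro _ ⟨⟨x, y⟩, h, rfl⟩ hd
  obtain ⟨n, hn⟩ := coe_eq_coe_iff_exists_int.1 (show (x : UnitAddCircle) = y from hd)
  obtain ⟨h₁, h₂⟩ := hYs h
  have hpos : (0 : ℝ) < n := by linarith
  have hlt : (n : ℝ) < 1 := by linarith
  norm_cast at hpos hlt
  lia

theorem WeaklyLocallyPathConnectedAt.of_preimage {X Y : Type*} [TopologicalSpace X]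
    [TopologicalSpace Y] {q : X → Y} (hq : Continuous q) (hqo : IsOpenMap q) {Z : Set Y} {p : X}
    (h : WeaklyLocallyPathConnectedAt (q ⁻¹' Z) p) : WeaklyLocallyPathConnectedAt Z (q p) := by
  intro U hU
  rw [eventually_nhdsWithin_iff]
  refine hqo.nhds_le p (mem_map.2 ?_)
  filter_upwards [eventually_nhdsWithin_iff.1 (h _ (hq.continuousAt hU))] with z hz hzZ
  exact ((hz hzZ).map hq).mono (image_preimage_subset q (Z ∩ U))

theorem IsContractible.exists_isPathLift {C : Set Config} (hC : IsContractible C)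
    (f : C(Config, UnitAddCircle)) : ∃ φ, IsPathLift f C φ := by
  obtain ⟨U, hU, _, rfl⟩ := hC
  obtain ⟨φ, hφ⟩ := Puppy.exists_isPathLift f U
  exact ⟨φ, hφ.mono hU.frontier_subset⟩

namespace Attraction

variable (D : Attraction) {Y Y' : Set (ℝ × ℝ)}

/-- The lifts of the critical configurations off the main diagonal. -/
def zeros : Set (ℝ × ℝ) := {z ∈ openStrip | D.g z.1 z.2 = 0}

/-- The critical configurations on the torus, the main diagonal included. -/
def torusZeros : Set Config := toTorus '' {z | D.g z.1 z.2 = 0}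

theorem isDiagPeriodic_zeros : IsDiagPeriodic D.zeros := fun x y =>
  and_congr (isDiagPeriodic_openStrip x y) (by simp [D.add_one_left, D.add_one_right])

theorem isDiagPeriodic_nonneg : IsDiagPeriodic {z | 0 ≤ D.g z.1 z.2} := fun x y => by
  simp [D.add_one_left, D.add_one_right]

theorem isClosed_zeros : IsClosed D.zeros := by
  obtain ⟨ε, hε, h⟩ := D.exists_margin
  have : D.zeros = {z | z.1 + ε ≤ z.2} ∩ {z | z.2 ≤ z.1 + 1 - ε} ∩ {z | D.g z.1 z.2 = 0} := by
    ext ⟨x, y⟩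
    refine ⟨fun ⟨⟨h₁, h₂⟩, h₀⟩ => ⟨⟨?_, ?_⟩, h₀⟩,
      fun ⟨⟨h₁, h₂⟩, h₀⟩ => ⟨⟨?_, ?_⟩, h₀⟩⟩
    · exact le_of_not_gt fun hy => ((h x y).1 h₁ hy).ne' h₀
    · exact le_of_not_gt fun hy => ((h x y).2 hy h₂).ne h₀
    all_goals simp only [mem_ofPred_eq] at *; linarith
  rw [this]
  exact ((isClosed_le (by fun_prop) (by fun_prop)).inter
    (isClosed_le (by fun_prop) (by fun_prop))).inter
      (isClosed_eq D.continuous_g continuous_const)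

theorem toTorus_mem_torusZeros : toTorus (x, y) ∈ D.torusZeros ↔ D.g x y = 0 := by
  refine ⟨?_, fun h => ⟨_, h, rfl⟩⟩
  rintro ⟨⟨x', y'⟩, h, heq⟩
  obtain ⟨m, n, rfl, rfl⟩ := toTorus_eq_iff.1 heq
  exact (D.g_add_int _ _ _ _).trans h

theorem weaklyLocallyPathConnectedAt_torusZeros {p : Config} (hp : p ∈ D.torusZeros) :
    WeaklyLocallyPathConnectedAt D.torusZeros p := by
  obtain ⟨⟨x, y⟩, h, rfl⟩ := hp
  refine .of_preimage continuous_toTorus isOpenMap_toTorus ?_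
  have hpre : toTorus ⁻¹' D.torusZeros = {z | D.g z.1 z.2 = 0} :=
    ext fun _ => D.toTorus_mem_torusZeros
  rw [hpre]
  by_cases hy : D.gy x y = 0
  · exact .of_preimage (p := (y, x)) continuous_swap (Homeomorph.prodComm ℝ ℝ).isOpenMap
      (weaklyLocallyPathConnectedAt_zeros (f := fun y x => D.g x y) (fy := fun y x => D.gx x y)
        (D.continuous_g.comp continuous_swap) (D.continuous_gx.comp continuous_swap)
        (fun y x => D.hasDerivAt_gx x y) h (D.gx_ne_zero x y h hy))
  · exact weaklyLocallyPathConnectedAt_zeros D.continuous_g D.continuous_gy D.hasDerivAt_gy h hy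

/-- The lift of a union of critical cycles other than the main diagonal. Such a union is relatively
clopen among the critical configurations off the diagonal, and only this is required. -/
structure IsBand (Y : Set (ℝ × ℝ)) : Prop where
  subset_zeros : Y ⊆ D.zeros
  isDiagPeriodic : IsDiagPeriodic Y
  isClosed : IsClosed Y
  isClosed_sdiff : IsClosed (D.zeros \ Y)

theorem isBand_zeros : D.IsBand D.zeros where
  subset_zeros := subset_rfl
  isDiagPeriodic := D.isDiagPeriodic_zeros
  isClosed := D.isClosed_zeros
  isClosed_sdiff := by simp

variable {D}

namespace IsBand

variable (hY : D.IsBand Y)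

include hY

theorem compl : D.IsBand (D.zeros \ Y) where
  subset_zeros := sdiff_subset
  isDiagPeriodic := D.isDiagPeriodic_zeros.sdiff hY.isDiagPeriodic
  isClosed := hY.isClosed_sdiff
  isClosed_sdiff := by
    rw [sdiff_sdiff_cancel_left hY.subset_zeros]
    exact hY.isClosed

theorem inter (hY' : D.IsBand Y') : D.IsBand (Y ∩ Y') where
  subset_zeros := inter_subset_left.trans hY.subset_zeros
  isDiagPeriodic := hY.isDiagPeriodic.inter hY'.isDiagPeriodic
  isClosed := hY.isClosed.inter hY'.isClosed
  isClosed_sdiff := by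
    rw [sdiff_inter]
    exact hY.isClosed_sdiff.union hY'.isClosed_sdiff

theorem subset_openStrip : Y ⊆ openStrip := hY.subset_zeros.trans (sep_subset _ _)

theorem isClosed_image : IsClosed (toTorus '' Y) :=
  isClosed_image_toTorus hY.isClosed hY.isDiagPeriodic hY.subset_openStrip

theorem image_subset_torusZeros : toTorus '' Y ⊆ D.torusZeros :=
  image_mono fun _ hz => (hY.subset_zeros hz).2

theorem disjoint_image (hY' : D.IsBand Y') (h : Disjoint Y Y') :
    Disjoint (toTorus '' Y) (toTorus '' Y') :=
  disjoint_image_toTorus hY.isDiagPeriodic hY.subset_openStrip hY'.subset_openStrip h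

theorem connectedComponentIn_subset {p : Config} (hp : p ∈ toTorus '' Y) :
    connectedComponentIn D.torusZeros p ⊆ toTorus '' Y := by
  have hcover : D.torusZeros ⊆
      toTorus '' Y ∪ (toTorus '' (D.zeros \ Y) ∪ diagonal UnitAddCircle) := by
    intro q hq
    obtain ⟨x, y, hxy, hyx, rfl⟩ := exists_toTorus q
    rcases hxy.eq_or_lt with rfl | hxy
    · exact .inr (.inr rfl)
    · have hz : (x, y) ∈ D.zeros := ⟨⟨hxy, hyx⟩, D.toTorus_mem_torusZeros.1 hq⟩
      exact (em ((x, y) ∈ Y)).imp (mem_image_of_mem _)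
        fun hY => .inl (mem_image_of_mem _ ⟨hz, hY⟩)
  have hdisj : Disjoint (toTorus '' Y) (toTorus '' (D.zeros \ Y) ∪ diagonal UnitAddCircle) :=
    (hY.disjoint_image hY.compl disjoint_sdiff_right).union_right
      (disjoint_image_toTorus_diagonal hY.subset_openStrip)
  have hpC := mem_connectedComponentIn (hY.image_subset_torusZeros hp)
  refine (isPreconnected_iff_subset_of_disjoint_closed.1 isPreconnected_connectedComponentIn _ _
    hY.isClosed_image (hY.compl.isClosed_image.union isClosed_diagonal)
    ((_root_.connectedComponentIn_subset _ _).trans hcover)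
    (by rw [hdisj.inter_eq, inter_empty])).resolve_right fun h => ?_
  exact disjoint_left.1 hdisj hp (h hpC)

theorem connectedComponentIn_ne (hY' : D.IsBand Y') (h : Disjoint Y Y') {p q : Config}
    (hp : p ∈ toTorus '' Y) (hq : q ∈ toTorus '' Y') :
    connectedComponentIn D.torusZeros p ≠ connectedComponentIn D.torusZeros q := fun heq =>
  disjoint_left.1 (hY.disjoint_image hY' h) hp <| hY'.connectedComponentIn_subset hq <|
    heq ▸ mem_connectedComponentIn (hY.image_subset_torusZeros hp)

/-- If all the cycles of `Y` were contractible, the position of the human would lift to a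
real-valued function on them. -/
theorem exists_not_isContractible {P Q : Set (ℝ × ℝ)} (hPQ : IsStripSeparation P Q)
    (h : ∀ x y, x ≤ y → y ≤ x + 1 → (x, y) ∈ P ∩ Q → (x, y) ∈ Y) :
    ∃ p ∈ toTorus '' Y, ¬ IsContractible (connectedComponentIn D.torusZeros p) := by
  by_contra! hcon
  let fst : C(Config, UnitAddCircle) := ⟨Prod.fst, continuous_fst⟩
  obtain ⟨φ, hφ⟩ := exists_continuous_lift_of_isPathLift fst hY.isClosed_image
    hY.image_subset_torusZeros
    (fun p hp => D.weaklyLocallyPathConnectedAt_torusZeros (hY.image_subset_torusZeros hp))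
    fun p hp => (hcon p hp).exists_isPathLift fst
  obtain ⟨x, y, hxy, hyx, hmem, hne⟩ := hPQ.exists_coe_ne (φ.continuous.comp continuous_toTorus)
    fun x y => congrArg φ (by simpa using toTorus_add_int x y 1 1)
  exact hne (hφ _ (mem_image_of_mem _ (h x y hxy hyx hmem)))

end IsBand

end Attraction

/-! ### Cutting the strip along a trap -/

theorem exists_mem_closure_of_mem_closure_image_fst {X Y : Type*} [TopologicalSpace X]
    [TopologicalSpace Y] {T : Set (X × Y)} {K : Set Y} (hK : IsCompact K) {x : X}
    (hTK : ∀ᶠ x' in 𝓝 x, ∀ y, (x', y) ∈ T → y ∈ K) (hx : x ∈ closure (Prod.fst '' T)) :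
    ∃ y, (x, y) ∈ closure T := by
  by_contra! h
  have hT : ∀ᶠ x' in 𝓝 x, ∀ y ∈ K, (x', y) ∉ T :=
    hK.eventually_forall_of_forall_eventually fun y _ => by
      simpa [mem_closure_iff_frequently] using h y
  obtain ⟨x', ⟨⟨_, y⟩, hT', rfl⟩, hK', h'⟩ :=
    ((mem_closure_iff_frequently.1 hx).and_eventually (hTK.and hT)).exists
  exact h' y (hK' y hT') hT'

/-- The half-turn of the plane that exchanges the two boundary lines of the strip. -/
def flip : ℝ × ℝ ≃ₜ ℝ × ℝ := (Homeomorph.neg ℝ).prodCongr (Homeomorph.subLeft 1)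

theorem flip_mk (x y : ℝ) : flip (x, y) = (-x, 1 - y) := rfl

theorem flip_flip (z : ℝ × ℝ) : flip (flip z) = z :=
  Prod.ext (neg_neg _) (sub_sub_cancel _ _)

theorem flip_mem_openStrip {z : ℝ × ℝ} : flip z ∈ openStrip ↔ z ∈ openStrip := by
  obtain ⟨x, y⟩ := z
  simp only [flip_mk, openStrip, mem_ofPred_eq]
  constructor <;> intro ⟨_, _⟩ <;> constructor <;> linarith

theorem IsDiagPeriodic.preimage_flip {Y : Set (ℝ × ℝ)} (hY : IsDiagPeriodic Y) :
    IsDiagPeriodic (flip ⁻¹' Y) := fun x y => by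
  rw [mem_preimage, mem_preimage, flip_mk, flip_mk, ← hY]
  ring_nf

namespace Attraction

/-- A set of stable points off the diagonal which the human and the puppy cannot leave, neither by
walking along stable points nor by a run from a pivot at the end of a walk. -/
structure IsTrap (D : Attraction) (R : Set (ℝ × ℝ)) : Prop where
  nonempty : R.Nonempty
  subset_openStrip : R ⊆ openStrip
  stable : ∀ x y, (x, y) ∈ R → D.Stable x y
  isDiagPeriodic : IsDiagPeriodic R
  near : ∀ x y, (x, y) ∈ closure R → ∀ᶠ z in 𝓝 (x, y), D.Stable z.1 z.2 → z ∈ R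
  forward : ∀ x y, (x, y) ∈ closure R → D.ForwardPivot x y → ∃ w, D.ForwardRun x y w ∧ (x, w) ∈ R
  backward : ∀ x y, (x, y) ∈ closure R → D.BackwardPivot x y →
    ∃ w, D.BackwardRun x y w ∧ (x, w) ∈ R

variable {D : Attraction} {R : Set (ℝ × ℝ)} {J : Set ℝ} {s : ℝ → ℝ} {x y w b : ℝ}

theorem closure_subset_of_stable (hRs : R ⊆ openStrip) (hR : ∀ x y, (x, y) ∈ R → D.Stable x y) :
    closure R ⊆ {z ∈ D.zeros | 0 ≤ D.gy z.1 z.2} :=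
  closure_minimal (fun z hz => ⟨⟨hRs hz, (hR z.1 z.2 hz).1⟩, (hR z.1 z.2 hz).2.le⟩)
    (D.isClosed_zeros.inter (isClosed_le continuous_const D.continuous_gy))

theorem stable_or_pivot (hg : D.g x y = 0) (hgy : 0 ≤ D.gy x y) :
    D.Stable x y ∨ D.ForwardPivot x y ∨ D.BackwardPivot x y := by
  rcases hgy.eq_or_lt with hgy | hgy
  · exact .inr ((D.gyy_ne_zero x y hg hgy.symm).lt_or_gt.imp (fun h => ⟨hg, hgy.symm, h⟩)
      fun h => ⟨hg, hgy.symm, h⟩)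
  · exact .inl ⟨hg, hgy⟩

theorem Stable.exists_isZeroBranch (h : D.Stable x y) :
    ∃ J ∈ 𝓝 x, ∃ s, IsZeroBranch D.g D.gy x y J s :=
  exists_isZeroBranch_of_pos D.continuous_g D.continuous_gy D.hasDerivAt_gy h.1 h.2

theorem ForwardPivot.exists_isZeroBranch (h : D.ForwardPivot x y) :
    ∃ J s, IsHalfNhd x J ∧ IsZeroBranch D.g D.gy x y J s :=
  exists_isZeroBranch_of_fold D.continuous_g D.continuous_gx D.continuous_gyy D.hasDerivAt_gx
    D.hasDerivAt_gy D.hasDerivAt_gyy h.1 h.2.1 (D.gx_ne_zero x y h.1 h.2.1) h.2.2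

/-- The part of `{0 ≤ g}` above a set `R`. -/
def upperPart (D : Attraction) (R : Set (ℝ × ℝ)) : Set (ℝ × ℝ) :=
  closure {z | 0 ≤ D.g z.1 z.2 ∧ ∃ y ≤ z.2, (z.1, y) ∈ R}

theorem upperPart_subset : D.upperPart R ⊆ {z | 0 ≤ D.g z.1 z.2} :=
  closure_minimal (sep_subset _ _) (isClosed_le continuous_const D.continuous_g)

theorem isDiagPeriodic_upperPart (hR : IsDiagPeriodic R) : IsDiagPeriodic (D.upperPart R) := by
  let shift : ℝ × ℝ ≃ₜ ℝ × ℝ := Homeomorph.addRight (1, 1)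
  have hshift : shift ⁻¹' D.upperPart R = D.upperPart R := by
    rw [upperPart, shift.preimage_closure]
    congr 1
    ext ⟨x, y⟩
    refine and_congr (by simp [shift, D.add_one_left, D.add_one_right]) ⟨?_, ?_⟩
    · rintro ⟨w, hw, h⟩
      exact ⟨w - 1, sub_le_iff_le_add.2 hw, (hR _ _).1 (by simpa [shift] using h)⟩
    · rintro ⟨w, hw, h⟩
      exact ⟨w + 1, by simpa [shift] using hw, (hR _ _).2 h⟩
  exact fun x y => Set.ext_iff.1 hshift (x, y)

theorem bottom_notMem_upperPart (hRs : R ⊆ openStrip) (hR : ∀ x y, (x, y) ∈ R → D.Stable x y)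
    (x : ℝ) : (x, x) ∉ D.upperPart R := by
  obtain ⟨ε, hε, hmargin⟩ := D.exists_margin
  have hsub : D.upperPart R ⊆ {z | z.1 + ε ≤ z.2} := by
    refine closure_minimal ?_ (isClosed_le (by fun_prop) (by fun_prop))
    rintro ⟨x, y⟩ ⟨-, w, hwy, hw⟩
    refine le_trans (not_lt.1 fun hlt => ?_) hwy
    exact ((hmargin x w).1 (hRs hw).1 hlt).ne' (hR x w hw).1
  intro h
  have : x + ε ≤ x := hsub h
  linarith

namespace IsTrap

variable (hR : D.IsTrap R)

include hR

theorem mem_or_pivot (h : (x, y) ∈ closure R) :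
    (x, y) ∈ R ∨ D.ForwardPivot x y ∨ D.BackwardPivot x y := by
  obtain ⟨h₀, h₁⟩ := closure_subset_of_stable hR.subset_openStrip hR.stable h
  exact (stable_or_pivot h₀.2 h₁).imp_left (hR.near x y h).self_of_nhds

theorem eventually_mem_of_isZeroBranch (hb : (x, b) ∈ closure R)
    (hs : IsZeroBranch D.g D.gy x b J s) : ∀ᶠ x' in 𝓝 x, x' ∈ J → (x', s x') ∈ R := by
  filter_upwards [hs.eventually_mem (hR.near x b hb)] with x' hmem hJ
  exact hmem (.inr hJ) (hs.zero x' hJ)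

theorem exists_mem (x : ℝ) : ∃ y, (x, y) ∈ R := by
  suffices h : Prod.fst '' R = univ by
    obtain ⟨⟨_, y⟩, hy, rfl⟩ := h.ge (mem_univ x)
    exact ⟨y, hy⟩
  refine IsClopen.eq_univ ⟨isClosed_of_closure_subset fun a ha => ?_, ?_⟩ (hR.nonempty.image _)
  · have hR_mem_Icc : ∀ᶠ x in 𝓝 a, ∀ y, (x, y) ∈ R → y ∈ Icc (a - 1) (a + 2) := by
      filter_upwards [Ioo_mem_nhds (sub_one_lt a) (lt_add_one a)] with x hx y hy
      obtain ⟨h₁, h₂⟩ := hR.subset_openStrip hy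
      constructor <;> linarith [hx.1, hx.2]
    obtain ⟨b, hb⟩ := exists_mem_closure_of_mem_closure_image_fst isCompact_Icc hR_mem_Icc ha
    rcases hR.mem_or_pivot hb with h | h | h
    · exact ⟨_, h, rfl⟩
    · obtain ⟨w, -, hw⟩ := hR.forward a b hb h
      exact ⟨_, hw, rfl⟩
    · obtain ⟨w, -, hw⟩ := hR.backward a b hb h
      exact ⟨_, hw, rfl⟩
  · rw [isOpen_iff_mem_nhds]
    rintro _ ⟨⟨a, b⟩, hb, rfl⟩
    obtain ⟨J, hJ, s, hs⟩ := (hR.stable a b hb).exists_isZeroBranch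
    filter_upwards [hR.eventually_mem_of_isZeroBranch (subset_closure hb) hs, hJ] with x hx hxJ
    exact ⟨_, hx hxJ, rfl⟩

theorem eventually_exists_le (hb : (x, b) ∈ closure R) (hs : IsZeroBranch D.g D.gy x b J s)
    (hby : b ≤ y) :
    ∀ᶠ z in 𝓝 (x, y), z.1 ∈ J → 0 ≤ D.g z.1 z.2 → ∃ v ≤ z.2, (z.1, v) ∈ R := by
  have hsR : ∀ᶠ z : ℝ × ℝ in 𝓝 (x, y), z.1 ∈ J → (z.1, s z.1) ∈ R :=
    (hR.eventually_mem_of_isZeroBranch hb hs).prod_inl_nhds y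
  have hle : ∀ᶠ z in 𝓝 (x, y), z.1 ∈ J → 0 ≤ D.g z.1 z.2 → s z.1 ≤ z.2 := by
    rcases hby.eq_or_lt with rfl | hby
    · exact hs.le_of_nonneg
    · obtain ⟨c, hbc, hcy⟩ := exists_between hby
      have hsc : ∀ᶠ x' in 𝓝 x, x' ∈ insert x J → s x' < c :=
        hs.eventually_mem (continuousAt_snd.eventually_lt_const hbc)
      have hsc' : ∀ᶠ z : ℝ × ℝ in 𝓝 (x, y), z.1 ∈ insert x J → s z.1 < c :=
        hsc.prod_inl_nhds y
      filter_upwards [hsc', continuousAt_snd.eventually_const_lt hcy] with z hz hcz hzJ _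
      exact (hz (.inr hzJ)).le.trans hcz.le
  filter_upwards [hsR, hle] with z hzR hz hzJ hg
  exact ⟨s z.1, hz hzJ hg, hzR hzJ⟩

theorem eventually_mem_upperPart_of_mem (hw : (x, w) ∈ R) (hwy : w ≤ y) :
    ∀ᶠ z in 𝓝 (x, y), 0 ≤ D.g z.1 z.2 → z ∈ D.upperPart R := by
  obtain ⟨J, hJ, s, hs⟩ := (hR.stable x w hw).exists_isZeroBranch
  have hJ' : ∀ᶠ z : ℝ × ℝ in 𝓝 (x, y), z.1 ∈ J := Eventually.prod_inl_nhds hJ y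
  filter_upwards [hR.eventually_exists_le (subset_closure hw) hs hwy, hJ'] with z hz hzJ hg
  exact subset_closure ⟨hg, hz hzJ hg⟩

/-- The branches that start at the two pivots lie on the same side of the vertical line, because
`(x, y)` is approached by points of `{0 ≤ g}` above `R`. -/
theorem eventually_mem_upperPart_of_forwardPivot (hb : D.ForwardPivot x b)
    (hy : D.ForwardPivot x y) (h : ((x, y), b) ∈
      closure {q : (ℝ × ℝ) × ℝ | 0 ≤ D.g q.1.1 q.1.2 ∧ q.2 ≤ q.1.2 ∧ (q.1.1, q.2) ∈ R})
    (hbR : (x, b) ∈ closure R) (hby : b ≤ y) (hyA : (x, y) ∈ D.upperPart R) :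
    ∀ᶠ z in 𝓝 (x, y), 0 ≤ D.g z.1 z.2 → z ∈ D.upperPart R := by
  obtain ⟨Jb, sb, hJb, hsb⟩ := hb.exists_isZeroBranch
  obtain ⟨Jy, sy, hJy, hsy⟩ := hy.exists_isZeroBranch
  have hcommon : (Jb ∩ Jy).Nonempty := by
    have hb_mem : ∀ᶠ q : (ℝ × ℝ) × ℝ in 𝓝 ((x, y), b),
        0 ≤ D.g q.1.1 q.2 → (q.1.1, q.2) = (x, b) ∨ q.1.1 ∈ Jb :=
      (by fun_prop : ContinuousAt (fun q : (ℝ × ℝ) × ℝ => (q.1.1, q.2)) ((x, y), b)).eventually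
        hsb.mem_of_nonneg
    have hy_mem : ∀ᶠ q : (ℝ × ℝ) × ℝ in 𝓝 ((x, y), b),
        0 ≤ D.g q.1.1 q.1.2 → q.1 = (x, y) ∨ q.1.1 ∈ Jy :=
      hsy.mem_of_nonneg.prod_inl_nhds b
    obtain ⟨⟨⟨x', y'⟩, v⟩, ⟨hg, -, hv⟩, hvb, hqy⟩ :=
      ((mem_closure_iff_frequently.1 h).and_eventually (hb_mem.and hy_mem)).exists
    have hst : D.Stable x' v := hR.stable _ _ hv
    have hx'b : x' ∈ Jb := (hvb hst.1.ge).resolve_left fun heq => by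
      obtain ⟨rfl, rfl⟩ := Prod.mk.inj heq
      exact hst.2.ne' hb.2.1
    exact ⟨x', hx'b, (hqy hg).resolve_left fun heq =>
      hJb.notMem ((Prod.mk.inj heq).1 ▸ hx'b)⟩
  have hJ : ∀ᶠ z : ℝ × ℝ in 𝓝 (x, y), z.1 ∈ Jy → z.1 ∈ Jb :=
    (hJb.eventually_mem_of_mem hJy hcommon).prod_inl_nhds y
  filter_upwards [hsy.mem_of_nonneg, hJ, hR.eventually_exists_le hbR hsb hby]
    with z hz hzJ hle hg
  rcases hz hg with rfl | hzy
  · exact hyA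
  · exact subset_closure ⟨hg, hle (hzJ hzy) hg⟩

theorem eventually_mem_upperPart (h : (x, y) ∈ D.upperPart R) :
    ∀ᶠ z in 𝓝 (x, y), 0 ≤ D.g z.1 z.2 → z ∈ D.upperPart R := by
  let T : Set ((ℝ × ℝ) × ℝ) := {q | 0 ≤ D.g q.1.1 q.1.2 ∧ q.2 ≤ q.1.2 ∧ (q.1.1, q.2) ∈ R}
  have hT : D.upperPart R = closure (Prod.fst '' T) := by
    rw [upperPart]
    congr 1
    ext z
    simp [T]
  have hT_mem_Icc : ∀ᶠ z : ℝ × ℝ in 𝓝 (x, y), ∀ v, (z, v) ∈ T → v ∈ Icc (x - 1) (y + 1) := by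
    filter_upwards [continuousAt_fst.eventually_const_lt (sub_one_lt x),
      continuousAt_snd.eventually_lt_const (lt_add_one y)] with z h₁ h₂ v hv
    exact ⟨(h₁.trans (hR.subset_openStrip hv.2.2).1).le, hv.2.1.trans h₂.le⟩
  obtain ⟨b, hb⟩ := exists_mem_closure_of_mem_closure_image_fst isCompact_Icc hT_mem_Icc (hT ▸ h)
  have hby : b ≤ y := closure_minimal (fun _ hq => hq.2.1)
    (isClosed_le (f := fun q : (ℝ × ℝ) × ℝ => q.2) (g := fun q => q.1.2)
      (by fun_prop) (by fun_prop)) hb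
  have hbR : (x, b) ∈ closure R := map_mem_closure (f := fun q : (ℝ × ℝ) × ℝ => (q.1.1, q.2))
    (by fun_prop) hb fun _ hq => hq.2.2
  rcases hR.mem_or_pivot hbR with hbR' | hbf | hbb
  · exact hR.eventually_mem_upperPart_of_mem hbR' hby
  · obtain ⟨w, ⟨-, -, hrun⟩, hw⟩ := hR.forward x b hbR hbf
    rcases le_or_gt w y with hwy | hyw
    · exact hR.eventually_mem_upperPart_of_mem hw hwy
    · have hyf : D.ForwardPivot x y := by
        rcases hby.eq_or_lt with rfl | hlt
        · exact hbf
        · exact (hrun y ⟨hlt, hyw⟩).resolve_left (upperPart_subset h).not_gt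
      exact hR.eventually_mem_upperPart_of_forwardPivot hbf hyf hb hbR hby h
  · obtain ⟨w, ⟨hwb, -⟩, hw⟩ := hR.backward x b hbR hbb
    exact hR.eventually_mem_upperPart_of_mem hw (hwb.le.trans hby)

theorem isClosed_sdiff_upperPart : IsClosed ({z | 0 ≤ D.g z.1 z.2} \ D.upperPart R) := by
  rw [← isOpen_compl_iff, isOpen_iff_eventually]
  intro p hp
  by_cases hg : 0 ≤ D.g p.1 p.2
  · have hpA : p ∈ D.upperPart R := not_not.1 fun h => hp ⟨hg, h⟩
    filter_upwards [hR.eventually_mem_upperPart hpA] with z hz hz'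
    exact hz'.2 (hz hz'.1)
  · filter_upwards [D.continuous_g.continuousAt.eventually_lt_const (not_le.1 hg)] with z hz hz'
    exact hz.not_ge hz'.1

theorem reflect : D.reflect.IsTrap (flip ⁻¹' R) where
  nonempty := hR.nonempty.preimage flip.surjective
  subset_openStrip z hz := flip_mem_openStrip.1 (hR.subset_openStrip hz)
  stable x y h := D.reflect_stable.2 (hR.stable _ _ h)
  isDiagPeriodic := hR.isDiagPeriodic.preimage_flip
  near x y h := by
    rw [← flip.preimage_closure] at h
    filter_upwards [flip.continuous.continuousAt.eventually (hR.near _ _ h)] with z hz hst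
    exact hz (D.reflect_stable.1 hst)
  forward x y h hp := by
    rw [← flip.preimage_closure] at h
    obtain ⟨w, hrun, hw⟩ := hR.backward _ _ h (D.reflect_forwardPivot.1 hp)
    exact ⟨1 - w, D.reflect_forwardRun.2 (by simpa using hrun), by simpa [flip_mk] using hw⟩
  backward x y h hp := by
    rw [← flip.preimage_closure] at h
    obtain ⟨w, hrun, hw⟩ := hR.forward _ _ h (D.reflect_backwardPivot.1 hp)
    exact ⟨1 - w, D.reflect_backwardRun.2 (by simpa using hrun), by simpa [flip_mk] using hw⟩

end IsTrap

/-- A part `A` of `{0 ≤ g}` and a part `B` of `{g ≤ 0}`, both relatively clopen, which contain the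
top and the bottom boundary line of the strip, respectively, and together all zeros of `g`. -/
structure IsCut (D : Attraction) (A B : Set (ℝ × ℝ)) : Prop where
  nonneg : A ⊆ {z | 0 ≤ D.g z.1 z.2}
  nonpos : B ⊆ {z | D.g z.1 z.2 ≤ 0}
  isClosed_left : IsClosed A
  isClosed_right : IsClosed B
  isClosed_sdiff_left : IsClosed ({z | 0 ≤ D.g z.1 z.2} \ A)
  isClosed_sdiff_right : IsClosed ({z | D.g z.1 z.2 ≤ 0} \ B)
  isDiagPeriodic_left : IsDiagPeriodic A
  isDiagPeriodic_right : IsDiagPeriodic B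
  bottom_notMem : ∀ x, (x, x) ∉ A
  top_notMem : ∀ x, (x, x + 1) ∉ B
  cover : ∀ x y, D.g x y = 0 → (x, y) ∈ A ∨ (x, y) ∈ B

theorem reflect_g_flip (z : ℝ × ℝ) : D.reflect.g (flip z).1 (flip z).2 = -D.g z.1 z.2 := by
  conv_rhs => rw [← flip_flip z]
  rfl

theorem IsTrap.isCut (hR : D.IsTrap R) :
    D.IsCut (D.upperPart R) (flip ⁻¹' D.reflect.upperPart (flip ⁻¹' R)) where
  nonneg := upperPart_subset
  nonpos z hz := by simpa [reflect_g_flip] using upperPart_subset hz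
  isClosed_left := isClosed_closure
  isClosed_right := isClosed_closure.preimage flip.continuous
  isClosed_sdiff_left := hR.isClosed_sdiff_upperPart
  isClosed_sdiff_right := by
    simpa [reflect_g_flip] using hR.reflect.isClosed_sdiff_upperPart.preimage flip.continuous
  isDiagPeriodic_left := isDiagPeriodic_upperPart hR.isDiagPeriodic
  isDiagPeriodic_right := (isDiagPeriodic_upperPart hR.reflect.isDiagPeriodic).preimage_flip
  bottom_notMem := bottom_notMem_upperPart hR.subset_openStrip hR.stable
  top_notMem x h := bottom_notMem_upperPart hR.reflect.subset_openStrip hR.reflect.stable (-x)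
    (by simpa [flip_mk] using h)
  cover x y hg := by
    obtain ⟨w, hw⟩ := hR.exists_mem x
    rcases le_total w y with hwy | hyw
    · exact .inl (subset_closure ⟨hg.ge, w, hwy, hw⟩)
    · refine .inr (subset_closure ⟨?_, 1 - w, sub_le_sub_left hyw 1, ?_⟩)
      · rw [reflect_g_flip, hg, neg_zero]
      · simpa [flip_mk] using hw

namespace IsCut

variable {A B : Set (ℝ × ℝ)} (h : D.IsCut A B)

include h

theorem bottom_mem (x : ℝ) : (x, x) ∈ B :=
  (h.cover x x (D.diag x)).resolve_left (h.bottom_notMem x)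

theorem top_mem (x : ℝ) : (x, x + 1) ∈ A :=
  (h.cover x (x + 1) ((D.add_one_right x x).trans (D.diag x))).resolve_right (h.top_notMem x)

theorem isBand_left : D.IsBand (D.zeros ∩ A) where
  subset_zeros := inter_subset_left
  isDiagPeriodic := D.isDiagPeriodic_zeros.inter h.isDiagPeriodic_left
  isClosed := D.isClosed_zeros.inter h.isClosed_left
  isClosed_sdiff := by
    convert! D.isClosed_zeros.inter h.isClosed_sdiff_left using 1
    ext z
    exact ⟨fun hz => ⟨hz.1, hz.1.2.ge, fun hA => hz.2 ⟨hz.1, hA⟩⟩,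
      fun hz => ⟨hz.1, fun hA => hz.2.2 hA.2⟩⟩

theorem isBand_right : D.IsBand (D.zeros ∩ B) where
  subset_zeros := inter_subset_left
  isDiagPeriodic := D.isDiagPeriodic_zeros.inter h.isDiagPeriodic_right
  isClosed := D.isClosed_zeros.inter h.isClosed_right
  isClosed_sdiff := by
    convert! D.isClosed_zeros.inter h.isClosed_sdiff_right using 1
    ext z
    exact ⟨fun hz => ⟨hz.1, hz.1.2.le, fun hB => hz.2 ⟨hz.1, hB⟩⟩,
      fun hz => ⟨hz.1, fun hB => hz.2.2 hB.2⟩⟩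

theorem exists_not_isContractible_below : ∃ p ∈ toTorus '' (D.zeros \ (D.zeros ∩ A)),
    ¬ IsContractible (connectedComponentIn D.torusZeros p) := by
  obtain ⟨ε, hε, hmargin⟩ := D.exists_margin
  refine h.isBand_left.compl.exists_not_isContractible
    (P := {z | 0 ≤ D.g z.1 z.2} \ A) (Q := A ∪ {z | D.g z.1 z.2 ≤ 0 ∧ z.1 + ε ≤ z.2}) ?_ ?_
  · have hclosed : IsClosed {z : ℝ × ℝ | z.1 + ε ≤ z.2} :=
      isClosed_le (by fun_prop) (by fun_prop)
    refine ⟨h.isClosed_sdiff_left, h.isClosed_left.union <|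
      (isClosed_le D.continuous_g continuous_const).inter hclosed,
      D.isDiagPeriodic_nonneg.sdiff h.isDiagPeriodic_left, fun x y hxy hyx => ?_,
      fun x => ⟨(D.diag x).ge, h.bottom_notMem x⟩, fun x => .inl (h.top_mem x)⟩
    by_cases hA : (x, y) ∈ A
    · exact .inr (.inl hA)
    by_cases hg : 0 ≤ D.g x y
    · exact .inl ⟨hg, hA⟩
    refine .inr (.inr ⟨(not_le.1 hg).le, not_lt.1 fun hyε => hg ?_⟩)
    rcases hxy.eq_or_lt with rfl | hxy
    exacts [(D.diag x).ge, ((hmargin x y).1 hxy hyε).le]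
  · rintro x y - hyx ⟨⟨hg, hA⟩, hA' | ⟨hg', hε'⟩⟩
    · exact absurd hA' hA
    have hne : y ≠ x + 1 := fun heq => hA (heq ▸ h.top_mem x)
    exact ⟨⟨⟨(lt_add_of_pos_right x hε).trans_le hε', hyx.lt_of_ne hne⟩, hg'.antisymm hg⟩,
      fun hz => hA hz.2⟩

theorem exists_not_isContractible_between : ∃ p ∈ toTorus '' (D.zeros ∩ A ∩ (D.zeros ∩ B)),
    ¬ IsContractible (connectedComponentIn D.torusZeros p) := by
  refine (h.isBand_left.inter h.isBand_right).exists_not_isContractible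
    (P := B ∪ ({z | 0 ≤ D.g z.1 z.2} \ A)) (Q := A ∪ ({z | D.g z.1 z.2 ≤ 0} \ B)) ?_ ?_
  · refine ⟨h.isClosed_right.union h.isClosed_sdiff_left,
      h.isClosed_left.union h.isClosed_sdiff_right,
      h.isDiagPeriodic_right.union (D.isDiagPeriodic_nonneg.sdiff h.isDiagPeriodic_left),
      fun x y _ _ => ?_, fun x => .inl (h.bottom_mem x), fun x => .inl (h.top_mem x)⟩
    by_cases hA : (x, y) ∈ A
    · exact .inr (.inl hA)
    by_cases hB : (x, y) ∈ B
    · exact .inl (.inl hB)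
    exact (le_total 0 (D.g x y)).imp (fun hg => .inr ⟨hg, hA⟩) fun hg => .inr ⟨hg, hB⟩
  · intro x y hxy hyx ⟨hP, hQ⟩
    obtain ⟨hA, hB⟩ : (x, y) ∈ A ∧ (x, y) ∈ B := by
      rcases hP with hB | ⟨hg, hA⟩ <;> rcases hQ with hA' | ⟨hg', hB'⟩
      · exact ⟨hA', hB⟩
      · exact absurd hB hB'
      · exact absurd hA' hA
      · exact ((h.cover x y (hg'.antisymm hg)).elim hA hB').elim
    have hbot : x ≠ y := fun heq => h.bottom_notMem x (by rwa [← heq] at hA)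
    have htop : y ≠ x + 1 := fun heq => h.top_notMem x (by rwa [heq] at hB)
    have hz : (x, y) ∈ D.zeros :=
      ⟨⟨hxy.lt_of_ne hbot, hyx.lt_of_ne htop⟩, (h.nonpos hB).antisymm (h.nonneg hA)⟩
    exact ⟨⟨hz, hA⟩, hz, hB⟩

theorem exists_not_isContractible_above : ∃ p ∈ toTorus '' (D.zeros \ (D.zeros ∩ B)),
    ¬ IsContractible (connectedComponentIn D.torusZeros p) := by
  obtain ⟨ε, hε, hmargin⟩ := D.exists_margin
  refine h.isBand_right.compl.exists_not_isContractible
    (P := B ∪ {z | 0 ≤ D.g z.1 z.2 ∧ z.2 ≤ z.1 + 1 - ε}) (Q := {z | D.g z.1 z.2 ≤ 0} \ B) ?_ ?_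
  · have hclosed : IsClosed {z : ℝ × ℝ | z.2 ≤ z.1 + 1 - ε} :=
      isClosed_le (by fun_prop) (by fun_prop)
    refine ⟨h.isClosed_right.union <|
      (isClosed_le continuous_const D.continuous_g).inter hclosed,
      h.isClosed_sdiff_right, h.isDiagPeriodic_right.union fun x y => ?_, fun x y hxy hyx => ?_,
      fun x => .inl (h.bottom_mem x), fun x => ⟨(?_ : D.g x (x + 1) = 0).le, h.top_notMem x⟩⟩
    · simp [D.add_one_left, D.add_one_right, add_sub_right_comm]
    · by_cases hB : (x, y) ∈ B
      · exact .inl (.inl hB)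
      by_cases hg : D.g x y ≤ 0
      · exact .inr ⟨hg, hB⟩
      refine .inl (.inr ⟨(not_le.1 hg).le, not_lt.1 fun hyε => hg ?_⟩)
      rcases hyx.eq_or_lt with rfl | hyx
      exacts [((D.add_one_right x x).trans (D.diag x)).le, ((hmargin x y).2 hyε hyx).le]
    · exact (D.add_one_right x x).trans (D.diag x)
  · rintro x y hxy - ⟨hB' | ⟨hg', hε'⟩, hg, hB⟩
    · exact absurd hB' hB
    have hne : x ≠ y := fun heq => hB (heq ▸ h.bottom_mem x)
    exact ⟨⟨⟨hxy.lt_of_ne hne, hε'.trans_lt (sub_lt_self _ hε)⟩, hg.antisymm hg'⟩,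
      fun hz => hB hz.2⟩

theorem three_le_encard :
    3 ≤ {C | (∃ p ∈ D.torusZeros, C = connectedComponentIn D.torusZeros p) ∧
      ¬ IsContractible C}.encard := by
  obtain ⟨p, hp, hpC⟩ := h.exists_not_isContractible_below
  obtain ⟨q, hq, hqC⟩ := h.exists_not_isContractible_between
  obtain ⟨r, hr, hrC⟩ := h.exists_not_isContractible_above
  have hbelow := h.isBand_left.compl
  have hbetween := h.isBand_left.inter h.isBand_right
  have habove := h.isBand_right.compl
  have hpq : Disjoint (D.zeros \ (D.zeros ∩ A)) (D.zeros ∩ A ∩ (D.zeros ∩ B)) :=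
    disjoint_sdiff_left.mono_right inter_subset_left
  have hqr : Disjoint (D.zeros ∩ A ∩ (D.zeros ∩ B)) (D.zeros \ (D.zeros ∩ B)) :=
    disjoint_sdiff_right.mono_left inter_subset_right
  have hpr : Disjoint (D.zeros \ (D.zeros ∩ A)) (D.zeros \ (D.zeros ∩ B)) := by
    rw [disjoint_left]
    exact fun z hzA hzB => (h.cover z.1 z.2 hzA.1.2).elim (fun hA => hzA.2 ⟨hzA.1, hA⟩)
      fun hB => hzB.2 ⟨hzA.1, hB⟩
  rw [← encard_eq_three.2 ⟨_, _, _, hbelow.connectedComponentIn_ne hbetween hpq hp hq,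
    hbelow.connectedComponentIn_ne habove hpr hp hr,
    hbetween.connectedComponentIn_ne habove hqr hq hr, rfl⟩]
  refine encard_le_encard ?_
  rintro C (rfl | rfl | rfl)
  exacts [⟨⟨p, hbelow.image_subset_torusZeros hp, rfl⟩, hpC⟩,
    ⟨⟨q, hbetween.image_subset_torusZeros hq, rfl⟩, hqC⟩,
    ⟨⟨r, habove.image_subset_torusZeros hr, rfl⟩, hrC⟩]

end IsCut

end Attraction

/-! ### Runs along vertical lines -/

namespace Attraction

variable {D : Attraction} {x y w : ℝ}

theorem Stable.not_runsForward (h : D.Stable x y) : ¬ D.RunsForward x y :=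
  fun hr => hr.elim (fun hg => hg.ne h.1) fun hp => h.2.ne' hp.2.1

theorem Stable.not_runsBackward (h : D.Stable x y) : ¬ D.RunsBackward x y :=
  fun hr => hr.elim (fun hg => hg.ne' h.1) fun hp => h.2.ne' hp.2.1

theorem RunsForward.g_nonpos (h : D.RunsForward x y) : D.g x y ≤ 0 :=
  h.elim le_of_lt fun hp => hp.1.le

theorem RunsBackward.g_nonneg (h : D.RunsBackward x y) : 0 ≤ D.g x y :=
  h.elim le_of_lt fun hp => hp.1.ge

theorem stable_self (x : ℝ) : D.Stable x x := ⟨D.diag x, D.gy_diag_pos x⟩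

theorem stable_add_natCast (x : ℝ) (n : ℕ) : D.Stable x (x + n) := by
  induction n with
  | zero => simpa using D.stable_self x
  | succ n ih =>
    rw [Nat.cast_succ, ← add_assoc]
    exact ⟨(D.add_one_right _ _).trans ih.1, ih.2.trans_eq (D.gy_add_one_right _ _).symm⟩

theorem tendsto_one_sub_nhdsGT (y : ℝ) : Tendsto (1 - ·) (𝓝[>] (1 - y)) (𝓝[<] y) := by
  refine tendsto_nhdsWithin_of_tendsto_nhds_of_eventually_within _ ?_ ?_
  · exact (Continuous.tendsto' (by fun_prop) _ _ (sub_sub_cancel 1 y)).mono_left inf_le_left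
  · filter_upwards [self_mem_nhdsWithin] with t (ht : 1 - y < t)
    exact sub_lt_comm.1 ht

theorem ForwardPivot.eventually_neg (h : D.ForwardPivot x y) : ∀ᶠ t in 𝓝[≠] y, D.g x t < 0 := by
  obtain ⟨J, s, hJ, hs⟩ := h.exists_isZeroBranch
  have hc : Tendsto (fun t => (x, t)) (𝓝 y) (𝓝 (x, y)) := Continuous.tendsto (by fun_prop) y
  filter_upwards [nhdsWithin_le_nhds (hc.eventually hs.mem_of_nonneg), self_mem_nhdsWithin]
    with t ht hne
  by_contra! hg
  exact (ht hg).elim (fun he => hne (Prod.mk.inj he).2) hJ.notMem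

theorem BackwardPivot.eventually_pos (h : D.BackwardPivot x y) : ∀ᶠ t in 𝓝[≠] y, 0 < D.g x t := by
  have hr : D.reflect.ForwardPivot (-x) (1 - y) := D.reflect_forwardPivot.2 (by simpa using h)
  have hc : Tendsto (1 - ·) (𝓝[≠] y) (𝓝[≠] (1 - y)) :=
    (Continuous.tendsto (by fun_prop) y).inf (tendsto_principal_principal.2 fun t ht => by simpa)
  filter_upwards [hc.eventually hr.eventually_neg] with t ht
  simpa [reflect_g] using ht

theorem ForwardPivot.not_backwardRun (h : D.ForwardPivot x y) : ¬ D.BackwardRun x y w := by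
  rintro ⟨hw, -, hrun⟩
  have hneg := h.eventually_neg.filter_mono (nhdsLT_le_nhdsNE y)
  obtain ⟨t, ht, ht'⟩ := (hneg.and (Ioo_mem_nhdsLT hw)).exists
  exact ht.not_ge (hrun t ht').g_nonneg

theorem BackwardPivot.not_forwardRun (h : D.BackwardPivot x y) : ¬ D.ForwardRun x y w := by
  rintro ⟨hw, -, hrun⟩
  have hpos := h.eventually_pos.filter_mono (nhdsGT_le_nhdsNE y)
  obtain ⟨t, ht, ht'⟩ := (hpos.and (Ioo_mem_nhdsGT hw)).exists
  exact ht.not_ge (hrun t ht').g_nonpos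

theorem ForwardRun.le_add_one (h : D.ForwardRun x y w) (hy : y < x + 1) : w ≤ x + 1 := by
  by_contra! hlt
  have hst : D.Stable x (x + 1) := by simpa using D.stable_add_natCast x 1
  exact hst.not_runsForward (h.2.2 _ ⟨hy, hlt⟩)

theorem BackwardRun.le (h : D.BackwardRun x y w) (hy : x < y) : x ≤ w := by
  by_contra! hlt
  exact (D.stable_self x).not_runsBackward (h.2.2 _ ⟨hlt, hy⟩)

theorem eventually_pos_left_or_runsForward (h : ¬ D.Stable x y) :
    (∀ᶠ t in 𝓝[<] y, 0 < D.g x t) ∨ ∀ᶠ t in 𝓝 y, D.RunsForward x t := by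
  have hc : ContinuousAt (D.g x) y := (D.hasDerivAt_gy x y).continuousAt
  obtain hg | hg | hg := lt_trichotomy (D.g x y) 0
  · exact .inr ((hc.eventually_lt_const hg).mono fun _ => .inl)
  · obtain hgy | hgy | hgy := lt_trichotomy (D.gy x y) 0
    · left
      have hd : deriv (D.g x) y < 0 := by rwa [(D.hasDerivAt_gy x y).deriv]
      filter_upwards [nhdsWithin_le_nhds (eventually_nhdsWithin_sign_eq_of_deriv_neg hd hg),
        self_mem_nhdsWithin] with t ht hlt
      rwa [sign_pos (sub_pos.2 hlt), sign_eq_one_iff] at ht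
    · obtain hgyy | hgyy := (D.gyy_ne_zero x y hg hgy).lt_or_gt
      · have hp : D.ForwardPivot x y := ⟨hg, hgy, hgyy⟩
        exact .inr (eventually_nhdsWithin_iff.1 hp.eventually_neg |>.mono fun t ht =>
          (eq_or_ne t y).elim (fun he => he ▸ .inr hp) fun hne => .inl (ht hne))
      · exact .inl (BackwardPivot.eventually_pos ⟨hg, hgy, hgyy⟩ |>.filter_mono
          (nhdsLT_le_nhdsNE y))
    · exact absurd ⟨hg, hgy⟩ h
  · exact .inl (nhdsWithin_le_nhds (hc.eventually_const_lt hg))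

theorem exists_forwardRun (h : ∀ᶠ t in 𝓝[>] y, D.RunsForward x t) :
    ∃ w, D.ForwardRun x y w := by
  let S : Set ℝ := {t | y < t ∧ ¬ D.RunsForward x t}
  have hne : S.Nonempty := by
    obtain ⟨n, hn⟩ := exists_nat_gt (y - x)
    exact ⟨x + n, sub_lt_iff_lt_add'.1 hn, (D.stable_add_natCast x n).not_runsForward⟩
  have hbdd : BddBelow S := ⟨y, fun t ht => ht.1.le⟩
  have hlt : y < sInf S := by
    obtain ⟨u, hu, hrun⟩ := mem_nhdsGT_iff_exists_Ioo_subset.1 h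
    exact lt_of_lt_of_le hu (le_csInf hne fun t ht => not_lt.1 fun htu => ht.2 (hrun ⟨ht.1, htu⟩))
  have hrun : ∀ t ∈ Ioo y (sInf S), D.RunsForward x t := fun t ht => by
    by_contra hr
    exact ht.2.not_ge (csInf_le hbdd ⟨ht.1, hr⟩)
  refine ⟨sInf S, hlt, ?_, hrun⟩
  by_contra hst
  obtain hpos | hrun' := eventually_pos_left_or_runsForward hst
  · obtain ⟨t, ht, ht'⟩ := (hpos.and (Ioo_mem_nhdsLT hlt)).exists
    exact ht.not_ge (hrun t ht').g_nonpos
  · obtain ⟨t, ht, ht'⟩ := mem_closure_iff_nhds.1 (csInf_mem_closure hne hbdd) _ hrun'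
    exact ht'.2 ht

theorem exists_backwardRun (h : ∀ᶠ t in 𝓝[<] y, D.RunsBackward x t) :
    ∃ w, D.BackwardRun x y w := by
  obtain ⟨w, hw⟩ := D.reflect.exists_forwardRun (x := -x) (y := 1 - y) <| by
    simpa only [reflect_runsForward, neg_neg] using (tendsto_one_sub_nhdsGT y).eventually h
  exact ⟨1 - w, by simpa using D.reflect_forwardRun.1 hw⟩

theorem exists_forwardRun_or_backwardRun (h : ¬ D.Stable x y) :
    (∃ w, D.ForwardRun x y w) ∨ ∃ w, D.BackwardRun x y w := by
  obtain hpos | hrun := eventually_pos_left_or_runsForward h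
  · exact .inr (exists_backwardRun (hpos.mono fun _ => .inl))
  · exact .inl (exists_forwardRun (nhdsWithin_le_nhds hrun))

end Attraction

/-! ### The attraction field of a generic track -/

section DistSq

variable {F : Type*} [NormedAddCommGroup F] {k : ℕ} {n : WithTop ℕ∞}

theorem hasDerivAt_iteratedDeriv [NormedSpace ℝ F] {f : ℝ → F} (hf : ContDiff ℝ n f)
    (hk : (k : WithTop ℕ∞) < n) (t : ℝ) :
    HasDerivAt (iteratedDeriv k f) (iteratedDeriv (k + 1) f t) t := by
  rw [iteratedDeriv_succ]
  exact (hf.differentiable_iteratedDeriv k hk t).hasDerivAt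

variable [InnerProductSpace ℝ F] {c : ℝ → F} (p : F)

theorem contDiff_dist_sq (hc : ContDiff ℝ n c) : ContDiff ℝ n fun t => dist p (c t) ^ 2 := by
  simpa only [dist_eq_norm] using (contDiff_const.sub hc).norm_sq ℝ

theorem iteratedDeriv_one_dist_sq (hc : ContDiff ℝ 1 c) :
    iteratedDeriv 1 (fun t => dist p (c t) ^ 2) =
      fun t => 2 * inner ℝ (c t - p) (iteratedDeriv 1 c t) := by
  funext t
  have hd := ((hasDerivAt_iteratedDeriv (k := 0) hc (by norm_num) t).sub_const p).norm_sq
  simpa only [iteratedDeriv_zero, iteratedDeriv_one, zero_add, dist_comm p, dist_eq_norm]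
    using hd.deriv

theorem iteratedDeriv_two_dist_sq (hc : ContDiff ℝ 2 c) :
    iteratedDeriv 2 (fun t => dist p (c t) ^ 2) = fun t =>
      2 * (inner ℝ (c t - p) (iteratedDeriv 2 c t) + ‖iteratedDeriv 1 c t‖ ^ 2) := by
  funext t
  have h₀ := (hasDerivAt_iteratedDeriv (k := 0) hc (by norm_num) t).sub_const p
  have h₁ := hasDerivAt_iteratedDeriv (k := 1) hc (by norm_num) t
  rw [iteratedDeriv_succ, iteratedDeriv_one_dist_sq p (hc.of_le (by norm_num)),
    ← real_inner_self_eq_norm_sq]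
  simpa only [iteratedDeriv_zero] using ((h₀.inner ℝ h₁).const_mul 2).deriv

theorem iteratedDeriv_inner_const_left (hc : ContDiff ℝ k c) (t : ℝ) :
    iteratedDeriv k (fun t => inner ℝ p (c t)) t = inner ℝ p (iteratedDeriv k c t) := by
  simp only [iteratedDeriv_eq_iteratedFDeriv]
  exact DFunLike.congr_fun ((innerSL ℝ p).iteratedFDeriv_comp_left hc.contDiffAt le_rfl) _

theorem continuous_iteratedDeriv_dist_sq (hc : ContDiff ℝ k c) (hk : 0 < k) :
    Continuous fun z : ℝ × ℝ => iteratedDeriv k (fun t => dist (c z.1) (c t) ^ 2) z.2 := by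
  have hexpand (x y : ℝ) : iteratedDeriv k (fun t => dist (c x) (c t) ^ 2) y =
      iteratedDeriv k (fun t => ‖c t‖ ^ 2) y - 2 * inner ℝ (c x) (iteratedDeriv k c y) := by
    have hsq : ContDiff ℝ k fun t => ‖c t‖ ^ 2 := hc.norm_sq ℝ
    have hin : ContDiff ℝ k fun t => inner ℝ (c x) (c t) := contDiff_const.inner ℝ hc
    simp only [dist_eq_norm, norm_sub_sq_real, sub_add_eq_add_sub, add_sub_assoc]
    rw [iteratedDeriv_const_add hk, iteratedDeriv_fun_sub hsq.contDiffAt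
      (contDiff_const.mul hin).contDiffAt, iteratedDeriv_const_mul _ hin.contDiffAt,
      iteratedDeriv_inner_const_left _ hc]
  simp only [hexpand]
  have hsq := (hc.norm_sq ℝ).continuous_iteratedDeriv k le_rfl
  have hck := hc.continuous_iteratedDeriv k le_rfl
  exact (hsq.comp continuous_snd).sub (continuous_const.mul
    ((hc.continuous.comp continuous_fst).inner (hck.comp continuous_snd)))

end DistSq

section

variable (γ : UnitAddCircle → Plane) (x y : ℝ)

theorem velocity_coe : velocity γ x = iteratedDeriv 1 (fun t : ℝ => γ t) x := by
  have h := deriv_comp_const_add (fun t : ℝ => γ t) x 0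
  rw [add_zero] at h
  rwa [iteratedDeriv_one]

theorem partialY_toTorus (k : ℕ) : partialY γ k (toTorus (x, y)) =
    iteratedDeriv k (fun t : ℝ => dist (γ x) (γ t) ^ 2) y := by
  have h := congrFun (iteratedDeriv_comp_const_add k (fun t : ℝ => dist (γ x) (γ t) ^ 2) y) 0
  rw [add_zero] at h
  exact h

end

namespace IsGenericTrack

variable {γ : UnitAddCircle → Plane} (hγ : IsGenericTrack γ)
include hγ

theorem contDiff_of_le {n : WithTop ℕ∞} (hn : n ≤ 3) : ContDiff ℝ n fun t : ℝ => γ t :=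
  hγ.contDiff.of_le hn

theorem continuous_partialY {k : ℕ} (hk₀ : 0 < k) (hk : k ≤ 3) :
    Continuous fun z : ℝ × ℝ => partialY γ k (toTorus (z.1, z.2)) := by
  simpa only [partialY_toTorus] using
    continuous_iteratedDeriv_dist_sq (hγ.contDiff_of_le (mod_cast hk)) hk₀

theorem hasDerivAt_partialY {k : ℕ} (hk : k < 3) (x y : ℝ) :
    HasDerivAt (fun y => partialY γ k (toTorus (x, y)))
      (partialY γ (k + 1) (toTorus (x, y))) y := by
  simpa only [partialY_toTorus] using
    hasDerivAt_iteratedDeriv (contDiff_dist_sq (γ x) hγ.contDiff) (mod_cast hk) y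

theorem isPivot_of_eq_zero {p : Config} (h₁ : partialY γ 1 p = 0) (h₂ : partialY γ 2 p = 0) :
    IsPivot γ p := by
  obtain h | h | h := hγ.exhaustive p h₁
  exacts [absurd h₂ h.2.ne', absurd h₂ h.2.ne, h]

/-- The attraction field lifting the attraction diagram of a generic track. -/
noncomputable def attraction : Attraction where
  g x y := partialY γ 1 (toTorus (x, y))
  gx x y := -(2 * inner ℝ (velocity γ x) (velocity γ y))
  gy x y := partialY γ 2 (toTorus (x, y))
  gyy x y := partialY γ 3 (toTorus (x, y))
  continuous_g := hγ.continuous_partialY one_pos (by norm_num)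
  continuous_gx := by
    have hv : Continuous fun t : ℝ => velocity γ t := by
      simpa only [velocity_coe] using hγ.contDiff.continuous_iteratedDeriv 1 (by norm_num)
    exact (continuous_const.mul ((hv.comp continuous_fst).inner (hv.comp continuous_snd))).neg
  continuous_gy := hγ.continuous_partialY two_pos (by norm_num)
  continuous_gyy := hγ.continuous_partialY three_pos le_rfl
  hasDerivAt_gx x y := by
    have hc := hasDerivAt_iteratedDeriv (k := 0) hγ.contDiff (by norm_num) x
    simp only [partialY_toTorus, iteratedDeriv_one_dist_sq _ (hγ.contDiff_of_le (by norm_num)),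
      velocity_coe]
    simpa using ((hc.const_sub (γ y)).inner ℝ
      (hasDerivAt_const x (iteratedDeriv 1 (fun t : ℝ => γ t) y))).const_mul 2
  hasDerivAt_gy := hγ.hasDerivAt_partialY (by norm_num)
  hasDerivAt_gyy := hγ.hasDerivAt_partialY (by norm_num)
  add_one_left x y := congrArg (partialY γ 1) (by simpa using toTorus_add_int x y 1 0)
  add_one_right x y := congrArg (partialY γ 1) (by simpa using toTorus_add_int x y 0 1)
  diag x := by
    simp [partialY_toTorus, iteratedDeriv_one_dist_sq _ (hγ.contDiff_of_le (by norm_num))]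
  gy_diag_pos x := by
    have hv := hγ.regular x
    rw [velocity_coe] at hv
    simpa [partialY_toTorus, iteratedDeriv_two_dist_sq _ (hγ.contDiff_of_le (by norm_num))]
      using pow_pos (norm_pos_iff.2 hv) 2
  gx_ne_zero _ _ h₁ h₂ := neg_ne_zero.2
    (mul_ne_zero two_ne_zero (hγ.transverse _ (hγ.isPivot_of_eq_zero h₁ h₂)))
  gyy_ne_zero _ _ h₁ h₂ := (hγ.isPivot_of_eq_zero h₁ h₂).elim (fun h => h.2.2.ne) fun h => h.2.2.ne'

end IsGenericTrack

/-! ### Walks and runs -/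

namespace Attraction

variable {D : Attraction} {x y : ℝ}

theorem reflect_stable_flip (z : ℝ × ℝ) :
    D.reflect.Stable (flip z).1 (flip z).2 ↔ D.Stable z.1 z.2 :=
  D.reflect_stable.trans (iff_of_eq (congrArg (fun z : ℝ × ℝ => D.Stable z.1 z.2) (flip_flip z)))

theorem exists_nhds_path_of_isZeroBranch {J : Set ℝ} {s : ℝ → ℝ}
    (h : IsZeroBranch D.g D.gy x y J s) :
    ∃ V ∈ 𝓝 (x, y), ∀ z ∈ V, ∀ z' ∈ V, z = (x, y) ∨ D.Stable z.1 z.2 → D.Stable z'.1 z'.2 →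
      ∃ w : Path z z', ∀ t, 0 < t → D.Stable (w t).1 (w t).2 := by
  obtain ⟨V, hV, hpath⟩ := h.exists_path univ_mem
  refine ⟨V, hV, fun z hz z' hz' hst hst' => ?_⟩
  obtain ⟨w, hw⟩ := hpath z hz z' hz' hst hst'.1 hst'.2
  exact ⟨w, fun t => (hw t).2⟩

theorem exists_nhds_path (hg : D.g x y = 0) (hgy : 0 ≤ D.gy x y) :
    ∃ V ∈ 𝓝 (x, y), ∀ z ∈ V, ∀ z' ∈ V, z = (x, y) ∨ D.Stable z.1 z.2 → D.Stable z'.1 z'.2 →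
      ∃ w : Path z z', ∀ t, 0 < t → D.Stable (w t).1 (w t).2 := by
  obtain hst | hp | hp := stable_or_pivot hg hgy
  · obtain ⟨J, -, s, hs⟩ := hst.exists_isZeroBranch
    exact exists_nhds_path_of_isZeroBranch hs
  · obtain ⟨J, s, -, hs⟩ := hp.exists_isZeroBranch
    exact exists_nhds_path_of_isZeroBranch hs
  · have hp' : D.reflect.ForwardPivot (-x) (1 - y) := D.reflect_forwardPivot.2 (by simpa using hp)
    obtain ⟨J, s, -, hs⟩ := hp'.exists_isZeroBranch
    obtain ⟨V, hV, hpath⟩ := exists_nhds_path_of_isZeroBranch hs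
    refine ⟨flip ⁻¹' V, flip.continuous.continuousAt.preimage_mem_nhds hV,
      fun z hz z' hz' hst hst' => ?_⟩
    obtain ⟨w, hw⟩ := hpath (flip z) hz (flip z') hz'
      (hst.imp (congrArg flip) (reflect_stable_flip z).2) ((reflect_stable_flip z').2 hst')
    exact ⟨(w.map flip.continuous).cast (flip_flip z).symm (flip_flip z').symm,
      fun t ht => D.reflect_stable.1 (hw t ht)⟩

end Attraction

variable {γ : UnitAddCircle → Plane}

theorem CanCatch.of_diag {p : Config} (h : p.1 = p.2) : CanCatch γ p := by
  obtain ⟨x, y⟩ := p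
  obtain rfl : x = y := h
  exact .caught x

theorem Run.isStable {p q : Config} (h : Run γ p q) : IsStable γ q := by
  obtain ⟨_, _, _, h, _⟩ | ⟨_, _, _, h, _⟩ := h <;> exact h

theorem Walk.of_path {z z' : ℝ × ℝ} (w : Path z z')
    (hw : ∀ t < 1, IsStable γ (toTorus (w t)))
    (hz' : IsStable γ (toTorus z') ∨ IsPivot γ (toTorus z')) :
    Walk γ (toTorus z) (toTorus z') :=
  ⟨⟨w.map continuous_toTorus, hw⟩, hz'⟩

/-- The lifts to the open strip of the stable configurations from which the puppy can escape. -/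
def escape (γ : UnitAddCircle → Plane) : Set (ℝ × ℝ) :=
  {z ∈ openStrip | IsStable γ (toTorus z) ∧ ¬ CanCatch γ (toTorus z)}

theorem isDiagPeriodic_escape : IsDiagPeriodic (escape γ) := fun x y => by
  have h : toTorus (x + 1, y + 1) = toTorus (x, y) := by simpa using toTorus_add_int x y 1 1
  exact and_congr (isDiagPeriodic_openStrip x y) (by rw [h])

theorem mem_escape {x y : ℝ} (hxy : x ≤ y) (hyx : y ≤ x + 1)
    (hst : IsStable γ (toTorus (x, y))) (hcatch : ¬ CanCatch γ (toTorus (x, y))) :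
    (x, y) ∈ escape γ := by
  refine ⟨⟨hxy.lt_of_ne ?_, hyx.lt_of_ne ?_⟩, hst, hcatch⟩
  · rintro rfl
    exact hcatch (.caught _)
  · rintro rfl
    exact hcatch (.of_diag (coe_eq_coe_iff_exists_int.2 ⟨1, by simp⟩))

namespace IsGenericTrack

variable (hγ : IsGenericTrack γ) {x y : ℝ} {p q : Config}
include hγ

theorem forwardRun_iff : ForwardRun γ (toTorus (x, y)) q ↔
    ∃ w, hγ.attraction.ForwardRun x y w ∧ toTorus (x, w) = q := by
  constructor
  · rintro ⟨s, hs, rfl, hst, hrun⟩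
    refine ⟨y + s, ⟨lt_add_of_pos_right y hs, hst, fun t ht => ?_⟩, rfl⟩
    have h := hrun (t - y) ⟨by linarith [ht.1], by linarith [ht.2]⟩
    rwa [toTorus, ← AddCircle.coe_add, add_sub_cancel] at h
  · rintro ⟨w, ⟨hyw, hst, hrun⟩, rfl⟩
    refine ⟨w - y, sub_pos.2 hyw, ?_, hst,
      fun t ht => hrun (y + t) ⟨by linarith [ht.1], by linarith [ht.2]⟩⟩
    simp [toTorus]

theorem backwardRun_iff : BackwardRun γ (toTorus (x, y)) q ↔
    ∃ w, hγ.attraction.BackwardRun x y w ∧ toTorus (x, w) = q := by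
  constructor
  · rintro ⟨s, hs, rfl, hst, hrun⟩
    refine ⟨y - s, ⟨sub_lt_self y hs, hst, fun t ht => ?_⟩, rfl⟩
    have h := hrun (y - t) ⟨by linarith [ht.2], by linarith [ht.1]⟩
    rwa [toTorus, ← AddCircle.coe_sub, sub_sub_cancel] at h
  · rintro ⟨w, ⟨hwy, hst, hrun⟩, rfl⟩
    refine ⟨y - w, sub_pos.2 hwy, ?_, hst,
      fun t ht => hrun (y - t) ⟨by linarith [ht.2], by linarith [ht.1]⟩⟩
    simp [toTorus]

theorem exists_run (hp : ¬ IsStable γ p) : ∃ q, Run γ p q := by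
  obtain ⟨x, y, -, -, rfl⟩ := exists_toTorus p
  obtain ⟨w, hw⟩ | ⟨w, hw⟩ :=
    Attraction.exists_forwardRun_or_backwardRun (D := hγ.attraction) (x := x) (y := y) hp
  · exact ⟨_, .inl (hγ.forwardRun_iff.2 ⟨w, hw, rfl⟩)⟩
  · exact ⟨_, .inr (hγ.backwardRun_iff.2 ⟨w, hw, rfl⟩)⟩

theorem closure_escape_subset :
    closure (escape γ) ⊆ {z ∈ hγ.attraction.zeros | 0 ≤ hγ.attraction.gy z.1 z.2} :=
  Attraction.closure_subset_of_stable (sep_subset _ _) fun _ _ h => h.2.1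

theorem exists_mem_nhds_walk (h : (x, y) ∈ closure (escape γ)) :
    ∃ V ∈ 𝓝 (x, y), ∃ z₀ ∈ escape γ, ∀ z ∈ V, z = (x, y) ∧ IsPivot γ (toTorus z) ∨
      IsStable γ (toTorus z) → Walk γ (toTorus z₀) (toTorus z) := by
  obtain ⟨⟨-, hg⟩, hgy⟩ := hγ.closure_escape_subset h
  obtain ⟨V, hV, hpath⟩ := Attraction.exists_nhds_path hg hgy
  obtain ⟨z₀, hz₀, hesc⟩ := mem_closure_iff_nhds.1 h V hV
  refine ⟨V, hV, z₀, hesc, fun z hz hend => ?_⟩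
  obtain ⟨w, hw⟩ := hpath z hz z₀ hz₀ (hend.imp_left And.left) hesc.2.1
  exact .of_path w.symm (fun t ht => hw (σ t) (symm_one ▸ symm_lt_symm.2 ht))
    (hend.symm.imp_right And.right)

theorem eventually_mem_escape (h : (x, y) ∈ closure (escape γ)) :
    ∀ᶠ z in 𝓝 (x, y), IsStable γ (toTorus z) → z ∈ escape γ := by
  obtain ⟨V, hV, z₀, hz₀, hwalk⟩ := hγ.exists_mem_nhds_walk h
  filter_upwards [hV, isOpen_openStrip.mem_nhds (hγ.closure_escape_subset h).1.1] with z hz hs hst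
  exact ⟨hs, hst, fun hcatch => hz₀.2.2 (.walk _ _ (hwalk z hz (.inr hst)) hcatch)⟩

theorem exists_escaping_run (hp : IsPivot γ (toTorus (x, y))) (h : (x, y) ∈ closure (escape γ)) :
    ∃ q, Run γ (toTorus (x, y)) q ∧ ¬ CanCatch γ q := by
  obtain ⟨V, hV, z₀, hz₀, hwalk⟩ := hγ.exists_mem_nhds_walk h
  by_contra! hcatch
  refine hz₀.2.2 (.walk _ _ (hwalk _ (mem_of_mem_nhds hV) (.inl ⟨rfl, hp⟩))
    (.run _ (hγ.exists_run fun hst => hst.2.ne' ?_) hcatch))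
  exact hp.elim (fun hp => hp.2.1) fun hp => hp.2.1

theorem isTrap_escape (hne : ∃ p, IsStable γ p ∧ ¬ CanCatch γ p) :
    hγ.attraction.IsTrap (escape γ) where
  nonempty := by
    obtain ⟨p, hst, hcatch⟩ := hne
    obtain ⟨x, y, hxy, hyx, rfl⟩ := exists_toTorus p
    exact ⟨(x, y), mem_escape hxy hyx.le hst hcatch⟩
  subset_openStrip := sep_subset _ _
  stable _ _ h := h.2.1
  isDiagPeriodic := isDiagPeriodic_escape
  near _ _ := hγ.eventually_mem_escape
  forward x y h hp := by
    obtain ⟨⟨hxy, hyx⟩, -⟩ := (hγ.closure_escape_subset h).1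
    obtain ⟨q, hq | hq, hcatch⟩ := hγ.exists_escaping_run (.inl hp) h
    · obtain ⟨w, hw, rfl⟩ := hγ.forwardRun_iff.1 hq
      exact ⟨w, hw, mem_escape (hxy.trans hw.1).le (hw.le_add_one hyx) hw.2.1 hcatch⟩
    · obtain ⟨w, hw, -⟩ := hγ.backwardRun_iff.1 hq
      exact absurd hw hp.not_backwardRun
  backward x y h hp := by
    obtain ⟨⟨hxy, hyx⟩, -⟩ := (hγ.closure_escape_subset h).1
    obtain ⟨q, hq | hq, hcatch⟩ := hγ.exists_escaping_run (.inr hp) h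
    · obtain ⟨w, hw, -⟩ := hγ.forwardRun_iff.1 hq
      exact absurd hw hp.not_forwardRun
    · obtain ⟨w, hw, rfl⟩ := hγ.backwardRun_iff.1 hq
      exact ⟨w, hw, mem_escape (hw.le hxy) (hw.1.trans hyx).le hw.2.1 hcatch⟩

theorem setOf_isCritical : {p | IsCritical γ p} = hγ.attraction.torusZeros := by
  ext p
  obtain ⟨x, y, -, -, rfl⟩ := exists_toTorus p
  exact hγ.attraction.toTorus_mem_torusZeros.symm

theorem isCritical_iff : IsCritical γ p ↔ p ∈ hγ.attraction.torusZeros := by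
  rw [← hγ.setOf_isCritical, mem_ofPred_eq]

theorem three_le_encard_essentialCycles (hne : ∃ p, IsStable γ p ∧ ¬ CanCatch γ p) :
    3 ≤ (essentialCycles γ).encard := by
  have h := (hγ.isTrap_escape hne).isCut.three_le_encard
  rwa [← hγ.setOf_isCritical] at h

theorem canCatch (hess : (essentialCycles γ).ncard = 2) (p : Config) : CanCatch γ p := by
  have hst : ∀ p, IsStable γ p → CanCatch γ p := by
    by_contra! hne
    have h3 := hγ.three_le_encard_essentialCycles hne
    rw [← (finite_of_ncard_ne_zero (by lia)).cast_ncard_eq, hess] at h3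
    norm_num at h3
  by_cases hp : IsStable γ p
  · exact hst p hp
  · exact .run p (hγ.exists_run hp) fun q hq => hst q hq.isStable

theorem diag_of_walk (hw : Walk γ p q) (hq : q.1 = q.2) : p.1 = p.2 := by
  obtain ⟨⟨f, hf⟩, hend⟩ := hw
  have hqc : IsCritical γ q :=
    hend.elim (fun h => h.1) fun h => h.elim (fun h => h.1) fun h => h.1
  have hfc (t : I) : f t ∈ hγ.attraction.torusZeros := by
    rw [← hγ.isCritical_iff]
    obtain ht | rfl := (le_one' (t := t)).lt_or_eq
    exacts [(hf t ht).1, f.target.symm ▸ hqc]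
  obtain ⟨x, y, hxy, hyx, rfl⟩ := exists_toTorus p
  obtain rfl | hlt := hxy.eq_or_lt
  · rfl
  have hp : toTorus (x, y) ∈ toTorus '' hγ.attraction.zeros :=
    mem_image_of_mem _ ⟨⟨hlt, hyx⟩, hγ.attraction.toTorus_mem_torusZeros.1 (f.source ▸ hfc 0)⟩
  have hsub := (isPreconnected_range f.continuous).subset_connectedComponentIn
    ⟨0, f.source⟩ (range_subset_iff.2 hfc)
  have hq' := hγ.attraction.isBand_zeros.connectedComponentIn_subset hp (hsub ⟨1, f.target⟩)
  exact absurd hq (disjoint_left.1 (disjoint_image_toTorus_diagonal (sep_subset _ _)) hq')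

theorem isDexter_or_isSinister (hp : CanCatch γ p) : IsDexter γ p ∨ IsSinister γ p := by
  have of_move {p q : Config} (hm : Move γ p q) (hq : q.1 ≠ q.2) :
      IsDexter γ q ∨ IsSinister γ q → IsDexter γ p ∨ IsSinister γ p := by
    rintro (h | h) <;> obtain ⟨a, b, hab, hrun⟩ := h.resolve_left hq
    exacts [.inl (.inr ⟨a, b, .head hm hab, hrun⟩), .inr (.inr ⟨a, b, .head hm hab, hrun⟩)]
  induction hp with
  | caught x => exact .inl (.inl rfl)
  | walk p q hw _ ih =>
    by_cases hq : q.1 = q.2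
    · exact .inl (.inl (hγ.diag_of_walk hw hq))
    · exact of_move (.inl hw) hq ih
  | run p hex _ ih =>
    obtain ⟨q, hr⟩ := hex
    by_cases hq : q.1 = q.2
    · exact hr.symm.imp (fun hr => .inr ⟨p, q, .refl, hr, hq⟩)
        fun hr => .inr ⟨p, q, .refl, hr, hq⟩
    · exact of_move (.inr hr) hq (ih q hr)

end IsGenericTrack

end Puppy

theorem mainTheorem3 (γ : UnitAddCircle → Puppy.Plane) (hγ : Puppy.IsGenericTrack γ)
    (hess : (Puppy.essentialCycles γ).ncard = 2) :
    (∀ p : Puppy.Config, Puppy.IsDexter γ p ∨ Puppy.IsSinister γ p) ∧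
      ∀ p : Puppy.Config, Puppy.CanCatch γ p :=
  ⟨fun p => hγ.isDexter_or_isSinister (hγ.canCatch hess p), hγ.canCatch hess⟩
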